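/- Let $\mathcal X,\mathcal Y$ be finite sets and write $\mathbb R^{\mathcal X\times\mathcal Y}$ with its componentwise order. For $f:\mathbb R^{\mathcal X\times\mathcal Y}\to\mathbb R\cup\{\pm\infty\}$ let $f^*(\mu)=\sup_U\{\mu^\top U-f(U)\}$ and $\operatorname{dom} f=\{f<+\infty\}$. A \emph{welfare function} is a convex, proper, lower semicontinuous function $G$ on $\mathbb R^{\mathcal X\times\mathcal Y}$ such that $\operatorname{dom}G^*$ is compact with least element $0$ (all such $G$ are finite-valued). It is \emph{submodular} if $G(p\wedge p')+G(p\vee p')\le G(p)+G(p')$ for all $p,p'\in\operatorname{dom} G$. With the convention $0\cdot\infty=0$, $G$ is extended to $(\mathbb R\cup\{-\infty\})^{\mathcal X\times\mathcal Y}$ by $G(U)=\max_{\mu}\{\mu^\top U-G^*(\mu)\}$, and $\partial G(U)=\{\mu\in\operatorname{dom}G^*: G(U)+G^*(\mu)=\mu^\top U\}$. Given welfare functions $G,H$ and $\alpha,\gamma\in\mathbb R^{\mathcal X\times\mathcal Y}$, a \emph{generalized equilibrium matching} is a triple $(\mu,U,V)$ with $\mu\in\mathbb R^{\mathcal X\times\mathcal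 Y}$ and $U,V\in(\mathbb R\cup\{-\infty\})^{\mathcal X\times\mathcal Y}$ such that $\max\{U-\alpha,V-\gamma\}=0$ componentwise and $\mu\in\partial G(U)\cap\partial H(V)$. Let $n^G,n^H\in\mathbb R^{\mathcal X\times\mathcal Y}$ be upper bounds of $\operatorname{dom}G^*$ and $\operatorname{dom}H^*$ respectively. The \emph{aggregated deferred acceptance algorithm} starts with $\mu^{A,0}=\min(n^G,n^H)$, $\mu^{T,-1}=0$ and iterates, for $k\ge 0$, with arbitrary choices of maximizers, $$\mu^{P,k}\in\operatorname*{argmax}_{\mu^{T,k-1}\le\mu\le\mu^{A,k}}\{\mu^\top\alpha-G^*(\mu)\},\qquad \mu^{T,k}\in\operatorname*{argmax}_{\mu\le\mu^{P,k}}\{\mu^\top\gamma-H^*(\mu)\},$$ $$\mu^{A,k+1}=\mu^{A,k}-(\mu^{P,k}-\mu^{T,k}),$$ where an argmax consists of points with finite objective value. Let $$T^G(\alpha,\bar\mu)=\operatorname*{argmax}_{\tau\in[0,+\infty]^{\mathcal X\times\mathcal Y}}\{\bar\mu^\top(\alpha-\tau)-G(\alpha-\tau)\},$$ define $T^H$ likewise,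 and put $\tau^{P,k}=\inf T^G(\alpha,\mu^{A,k})$ and $\tau^{T,k}=\inf T^H(\gamma,\mu^{P,k})$ (componentwise infima). \textbf{Theorem.} Let $G,H$ be submodular welfare functions and $\alpha,\gamma\in\mathbb R^{\mathcal X\times\mathcal Y}$. For all $n^G,n^H$ as above: (1) The algorithm is well defined: at every step, whatever maximizers were chosen before, the argmax sets of the proposal and disposal phases are non-empty, and the sets $T^G(\alpha,\mu^{A,k})$, $T^H(\gamma,\mu^{P,k})$ are non-empty and contain their componentwise infima. In particular, infinite runs exist. (2) For every infinite run, the sequence $(\mu^{P,k},\tau^{P,k},\tau^{T,k})_k$ has a convergent subsequence, with limit in $\mathbb R^{\mathcal X\times\mathcal Y}\times[0,+\infty]^{\mathcal X\times\mathcal Y}\times[0,+\infty]^{\mathcal X\times\mathcal Y}$. (3) For every infinite run and every limit $(\mu,\tau^P,\tau^T)$ of a convergent subsequence, the triple $(\mu,\alpha-\tau^\alpha,\gamma-\tau^\gamma)$ is a generalized equilibrium matching, where $\tau^\alpha_{xy}=\tau^P_{xy}$ if $\mu_{xy}<n^G_{xy}$ and $\tau^\alpha_{xy}=0$ otherwise,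 and $\tau^\gamma_{xy}=\tau^T_{xy}$ if $\mu_{xy}<n^H_{xy}$ and $\tau^\gamma_{xy}=0$ otherwise. In particular, a generalized equilibrium matching between $G$ and $H$ with initial preferences $\alpha,\gamma$ exists. -/

import Mathlib

open Filter Topology

namespace AggDA

noncomputable section

/-- Effective domain of an extended-real-valued function. -/
def dom {ι : Type*} (f : (ι → ℝ) → EReal) : Set (ι → ℝ) := {x | f x < ⊤}

/-- Convexity of an extended-real-valued function: its epigraph is convex. -/
def IsConvex {ι : Type*} (f : (ι → ℝ) → EReal) : Prop :=
  Convex ℝ {z : (ι → ℝ) × ℝ | f z.1 ≤ (z.2 : EReal)}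

/-- A function is proper if it never takes the value `-∞` and is finite somewhere. -/
def IsProper {ι : Type*} (f : (ι → ℝ) → EReal) : Prop :=
  (∀ x, f x ≠ ⊥) ∧ (dom f).Nonempty

/-- Legendre transform (convex conjugate) `f*(μ) = sup_U (μ · U - f(U))`. -/
def conj {ι : Type*} [Fintype ι] (f : (ι → ℝ) → EReal) (μ : ι → ℝ) : EReal :=
  ⨆ U : ι → ℝ, ((∑ i, μ i * U i : ℝ) : EReal) - f U

/-- Submodularity with respect to the componentwise lattice operations. -/
def IsSubmodular {ι : Type*} (f : (ι → ℝ) → EReal) : Prop :=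
  ∀ p ∈ dom f, ∀ p' ∈ dom f, f (p ⊓ p') + f (p ⊔ p') ≤ f p + f p'

/-- Welfare functions: convex, proper, lower semicontinuous functions `G` such that `dom G*` is
compact with least element `0` for the componentwise order. -/
structure IsWelfare {ι : Type*} [Fintype ι] (G : (ι → ℝ) → EReal) : Prop where
  convex : IsConvex G
  proper : IsProper G
  lsc : LowerSemicontinuous G
  compact_dom : IsCompact (dom (conj G))
  isLeast_zero : IsLeast (dom (conj G)) 0

/-- The pairing `μ · U` of a real vector with an extended-real vector, with `0 * (-∞) = 0`. -/
def pairing {ι : Type*} [Fintype ι] (μ : ι → ℝ) (U : ι → EReal) : EReal :=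
  ∑ i, (μ i : EReal) * U i

/-- Extension of a welfare function to vectors with entries in `ℝ ∪ {-∞}`:
`G(U) = max_μ (μ · U - G*(μ))`. Only vectors without entry `+∞` are relevant. -/
def ext {ι : Type*} [Fintype ι] (G : (ι → ℝ) → EReal) (U : ι → EReal) : EReal :=
  ⨆ μ : ι → ℝ, pairing μ U - conj G μ

/-- The subdifferential `∂G(U)` at a vector `U` with entries in `ℝ ∪ {-∞}`: all `μ ∈ dom G*` with
`G*(μ) + G(U) = μ · U`. -/
def subdiff {ι : Type*} [Fintype ι] (G : (ι → ℝ) → EReal) (U : ι → EReal) : Set (ι → ℝ) :=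
  {μ | μ ∈ dom (conj G) ∧ conj G μ + ext G U = pairing μ U}

/-- The maximizers of `F` over `S`. If `F` is identically `-∞` on `S`, there is none. -/
def argmaxOn {β : Type*} (S : Set β) (F : β → EReal) : Set β :=
  {x | x ∈ S ∧ F x ≠ ⊥ ∧ ∀ y ∈ S, F y ≤ F x}

/-- The objective `μ · α - G*(μ)`. -/
def objective {ι : Type*} [Fintype ι] (G : (ι → ℝ) → EReal) (α : ι → ℝ) (μ : ι → ℝ) : EReal :=
  ((∑ i, μ i * α i : ℝ) : EReal) - conj G μ

/-- Proposal phase: `argmax_{lo ≤ μ ≤ hi} μ · α - G*(μ)`. -/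
def proposals {ι : Type*} [Fintype ι] (G : (ι → ℝ) → EReal) (α lo hi : ι → ℝ) : Set (ι → ℝ) :=
  argmaxOn {μ | lo ≤ μ ∧ μ ≤ hi} (objective G α)

/-- Disposal phase: `argmax_{μ ≤ hi} μ · γ - H*(μ)`. -/
def disposals {ι : Type*} [Fintype ι] (H : (ι → ℝ) → EReal) (γ hi : ι → ℝ) : Set (ι → ℝ) :=
  argmaxOn {μ | μ ≤ hi} (objective H γ)

/-- The vector `α - τ`, for real `α` and `τ` with entries in `[0, +∞]`. -/
def reduce {ι : Type*} (α : ι → ℝ) (τ : ι → EReal) : ι → EReal := fun i => (α i : EReal) - τ i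

/-- The set of Lagrange multipliers
`T^G(α, m) = argmax_{τ ∈ [0, +∞]^ι} m · (α - τ) - G(α - τ)`. -/
def multipliers {ι : Type*} [Fintype ι] (G : (ι → ℝ) → EReal) (α m : ι → ℝ) : Set (ι → EReal) :=
  argmaxOn {τ | 0 ≤ τ} (fun τ => pairing m (reduce α τ) - ext G (reduce α τ))

/-- The componentwise infimum of `T^G(α, m)`. -/
def leastMultiplier {ι : Type*} [Fintype ι] (G : (ι → ℝ) → EReal) (α m : ι → ℝ) : ι → EReal :=
  sInf (multipliers G α m)

/-- `Reachable G H α γ nG nH A T`: after finitely many (possibly zero) complete rounds, for some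
choice of maximizers, the algorithm may enter the next round with available offers `A`, the offers
retained in the previous round being `T` (`T = 0` at the start). -/
inductive Reachable {ι : Type*} [Fintype ι] (G H : (ι → ℝ) → EReal) (α γ nG nH : ι → ℝ) :
    (ι → ℝ) → (ι → ℝ) → Prop
  | init : Reachable G H α γ nG nH (nG ⊓ nH) 0
  | round {A T P T' : ι → ℝ} : Reachable G H α γ nG nH A T → P ∈ proposals G α T A →
      T' ∈ disposals H γ P → Reachable G H α γ nG nH (A - (P - T')) T'

/-- The sequence `μT` delayed by one step, starting with `0`. -/
def delayed {ι : Type*} (μT : ℕ → ι → ℝ) : ℕ → ι → ℝ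
  | 0 => 0
  | k + 1 => μT k

/-- `(μA, μP, μT)` is a sequence of iterates of the aggregated deferred acceptance algorithm. -/
structure IsRun {ι : Type*} [Fintype ι] (G H : (ι → ℝ) → EReal) (α γ nG nH : ι → ℝ)
    (μA μP μT : ℕ → ι → ℝ) : Prop where
  init : μA 0 = nG ⊓ nH
  proposal : ∀ k, μP k ∈ proposals G α (delayed μT k) (μA k)
  disposal : ∀ k, μT k ∈ disposals H γ (μP k)
  update : ∀ k, μA (k + 1) = μA k - (μP k - μT k)

/-- Generalized equilibrium matchings `(μ, U, V)` between the welfare functions `G` and `H`, with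
initial preferences `α` and `γ`; `U` and `V` have entries in `ℝ ∪ {-∞}`. -/
structure IsGenEquilibrium {ι : Type*} [Fintype ι] (G H : (ι → ℝ) → EReal) (α γ : ι → ℝ)
    (μ : ι → ℝ) (U V : ι → EReal) : Prop where
  U_ne_top : ∀ i, U i ≠ ⊤
  V_ne_top : ∀ i, V i ≠ ⊤
  max_eq_zero : ∀ i, max (U i - (α i : EReal)) (V i - (γ i : EReal)) = 0
  mem_subdiff : μ ∈ subdiff G U ∩ subdiff H V

end

end AggDA

/-!
By a minimax argument, submodularity of `G` becomes an exchange property of `G*`: some of the excess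
of one point of `dom G*` over another can be moved between them without increasing the sum of the
values of `G*`. Thus when the available offers shrink, the unconstrained optimal proposals can be
chosen above the retained offers, so that the proposal phase is always feasible and its constraint
from below never binds. Strong duality makes `T^G(α, A)` the set of multipliers of the constraint
`μ ≤ A`: the proposal is a subgradient of `G` at `α - τ`, and a component with positive price `τ`
exhausts what is available. Submodularity passes to the extension of `G` and makes these sets of
multipliers closed under infima, with least elements decreasing in `A`.

Available offers decrease along a run, hence the rejected offers `μP - μT` tend to `0` and proposals
and disposals have the same limits, at which the subgradient relations persist. Since
`μT k ≤ μP (k + 1)`, the disposal prices decrease; an offer whose disposal price stays positive has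
never been rejected, and if its proposal price is positive as well, then it is used up to the
initial bound. There `α - τ` may be raised to `α` or `γ - τ` to `γ` without losing the subgradient.
-/

namespace AggDA

open scoped Matrix

section Compactness

theorem exists_forall_le_of_forall_exists_le {E F β : Type*} [LinearOrder β] [DenselyOrdered β]
    [TopologicalSpace E] [AddCommGroup E] [Module ℝ E] [IsTopologicalAddGroup E]
    [ContinuousSMul ℝ E] [TopologicalSpace F] [AddCommGroup F] [Module ℝ F]
    [IsTopologicalAddGroup F] [ContinuousSMul ℝ F] {X : Set E} {Y : Set F} {f : E → F → β}
    (ne_X : X.Nonempty) (kX : IsCompact X) (cX : Convex ℝ X) (cY : Convex ℝ Y)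
    (hfy : ∀ y ∈ Y, LowerSemicontinuousOn (fun x => f x y) X)
    (hfy' : ∀ y ∈ Y, QuasiconvexOn ℝ X fun x => f x y)
    (hfx : ∀ x ∈ X, UpperSemicontinuousOn (fun y => f x y) Y)
    (hfx' : ∀ x ∈ X, QuasiconcaveOn ℝ Y fun y => f x y)
    {t : β} (h : ∀ y ∈ Y, ∃ x ∈ X, f x y ≤ t) :
    ∃ x ∈ X, ∀ y ∈ Y, f x y ≤ t := by
  by_contra! hcon
  have hempty : X ∩ ⋂ y ∈ Y, (f · y) ⁻¹' Set.Iic t = ∅ := by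
    refine Set.eq_empty_iff_forall_notMem.2 fun x ⟨hx, hxY⟩ => ?_
    obtain ⟨y, hy, hlt⟩ := hcon x hx
    exact hlt.not_ge (Set.mem_iInter₂.1 hxY y hy)
  obtain ⟨u, hu⟩ := (LowerSemicontinuousOn.inter_biInter_preimage_Iic_eq_empty_iff_exists_finset
    (f := fun y x => f x y) kX hfy).1 hempty
  have hu' : ∀ x ∈ X, ∃ y ∈ Subtype.val '' (u : Set Y), t < f x y := fun x hx =>
    let ⟨y, hy, hlt⟩ := hu x hx
    ⟨y, ⟨y, hy, rfl⟩, hlt⟩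
  obtain ⟨y, hy, hlt⟩ := Sion.exists_lt_iInf_of_lt_iInf_of_finite ne_X kX hfy hfy' cY hfx hfx' cX
    (u.finite_toSet.image Subtype.val) (Subtype.coe_image_subset _ _) hu'
  obtain ⟨x, hx, hle⟩ := h y hy
  exact (hlt x hx).not_ge hle

theorem isLeast_sInf_of_infClosed {E : Type*} [CompleteLattice E] [TopologicalSpace E]
    [InfConvergenceClass E] {s : Set E} (hs : InfClosed s) (hne : s.Nonempty)
    (hclosed : IsClosed s) : IsLeast s (sInf s) := by
  have := hne.to_subtype
  have : IsCodirectedOrder s := ⟨fun x y =>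
    ⟨⟨x ⊓ y, hs x.2 y.2⟩, inf_le_left (a := (x : E)), inf_le_right (a := (x : E))⟩⟩
  have hlim : Tendsto ((↑) : s → E) atBot (𝓝 (sInf s)) :=
    tendsto_atBot_isGLB (Subtype.mono_coe s) (by simpa using isGLB_sInf s)
  exact ⟨hclosed.mem_of_tendsto hlim (.of_forall Subtype.coe_prop), fun _ => sInf_le⟩

variable {β : Type*} {S : Set β} {F : β → EReal}

theorem argmaxOn_inter_subset {S' : Set β} (hSS' : S' ⊆ S) :
    argmaxOn S F ∩ S' ⊆ argmaxOn S' F :=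
  fun _ hx => ⟨hx.2, hx.1.2.1, fun y hy => hx.1.2.2 y (hSS' hy)⟩

variable [TopologicalSpace β]

theorem argmaxOn_nonempty (hS : IsCompact S) (hF : UpperSemicontinuousOn F S) {x : β} (hx : x ∈ S)
    (hFx : F x ≠ ⊥) : (argmaxOn S F).Nonempty :=
  let ⟨m, hm, hmax⟩ := hF.exists_isMaxOn ⟨x, hx⟩ hS
  ⟨m, hm, ne_bot_of_le_ne_bot hFx (hmax hx), fun _ hy => hmax hy⟩

theorem isClosed_argmaxOn (hS : IsClosed S) (hF : UpperSemicontinuousOn F S) :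
    IsClosed (argmaxOn S F) := by
  rcases (argmaxOn S F).eq_empty_or_nonempty with hempty | ⟨m, hmS, hm, hmax⟩
  · exact hempty ▸ isClosed_empty
  obtain ⟨v, hv, hSv⟩ := upperSemicontinuousOn_iff_preimage_Ici.1 hF (F m)
  have hlevel : argmaxOn S F = S ∩ F ⁻¹' Set.Ici (F m) := Set.ext fun x =>
    ⟨fun hx => ⟨hx.1, hx.2.2 m hmS⟩, fun hx =>
      ⟨hx.1, ne_bot_of_le_ne_bot hm hx.2, fun y hy => (hmax y hy).trans hx.2⟩⟩
  exact hlevel ▸ hSv ▸ hS.inter hv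

end Compactness

section EReal

theorem iSup_add_iSup_le {ι κ : Sort*} {f : ι → EReal} {g : κ → EReal} {c : EReal}
    (h : ∀ i j, f i + g j ≤ c) : iSup f + iSup g ≤ c :=
  EReal.add_le_of_forall_lt fun _ ha _ hb =>
    let ⟨i, hi⟩ := lt_iSup_iff.1 ha
    let ⟨j, hj⟩ := lt_iSup_iff.1 hb
    (add_le_add hi.le hj.le).trans (h i j)

theorem sub_coe_add_sub_coe (a b : EReal) (c d : ℝ) :
    a - c + (b - d) = a + b - (c + d : ℝ) := by
  simp only [sub_eq_add_neg, add_add_add_comm a, ← EReal.coe_neg, ← EReal.coe_add, ← neg_add]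

/-- Moving weight to the larger of two values pays. -/
theorem mul_add_mul_le_of_rearrange {a b a' b' : ℝ} {u v : EReal} (ha : 0 ≤ a) (ha' : 0 ≤ a')
    (hsum : a + b = a' + b') (hle : a' ≤ b) (huv : u ≤ v) :
    (a * v + b * u : EReal) ≤ a' * u + b' * v := by
  obtain ⟨d, hd, rfl⟩ : ∃ d, 0 ≤ d ∧ b = a' + d := ⟨b - a', by linarith, by ring⟩
  obtain rfl : b' = a + d := by linarith
  have hd' : (0 : EReal) ≤ d := mod_cast hd
  calc (a * v + (a' + d : ℝ) * u : EReal) = a' * u + (a * v + d * u) := by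
        rw [EReal.coe_add, EReal.right_distrib_of_nonneg (mod_cast ha') hd', add_left_comm]
    _ ≤ a' * u + (a * v + d * v) := by gcongr
    _ = a' * u + (a + d : ℝ) * v := by
        rw [EReal.coe_add, EReal.right_distrib_of_nonneg (mod_cast ha) hd']

theorem lowerSemicontinuousOn_toReal {X : Type*} [TopologicalSpace X] {g : X → EReal} {s : Set X}
    (hbot : ∀ x ∈ s, g x ≠ ⊥) (htop : ∀ x ∈ s, g x ≠ ⊤) (hg : LowerSemicontinuousOn g s) :
    LowerSemicontinuousOn (fun x => (g x).toReal) s := by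
  intro x hx c hc
  have hc' : (c : EReal) < g x := (EReal.coe_lt_coe hc).trans_eq
    (EReal.coe_toReal (htop x hx) (hbot x hx))
  filter_upwards [hg x hx c hc', self_mem_nhdsWithin] with y hy hys
  exact EReal.coe_lt_coe_iff.1 (hy.trans_eq (EReal.coe_toReal (htop y hys) (hbot y hys)).symm)

end EReal

section Proper

variable {ι : Type*} {f : (ι → ℝ) → EReal} {x y : ι → ℝ}

theorem mem_dom_iff : x ∈ dom f ↔ f x ≠ ⊤ := by
  rw [dom, Set.mem_ofPred_eq, lt_top_iff_ne_top]

theorem eq_top_of_notMem_dom (hx : x ∉ dom f) : f x = ⊤ :=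
  not_lt_top_iff.1 hx

theorem IsProper.coe_toReal (hf : IsProper f) (hx : x ∈ dom f) : ((f x).toReal : EReal) = f x :=
  EReal.coe_toReal (mem_dom_iff.1 hx) (hf.1 x)

theorem IsProper.lowerSemicontinuousOn_toReal (hf : IsProper f) (hl : LowerSemicontinuous f) :
    LowerSemicontinuousOn (fun x => (f x).toReal) (dom f) :=
  AggDA.lowerSemicontinuousOn_toReal (fun x _ => hf.1 x) (fun _ => mem_dom_iff.1)
    (hl.lowerSemicontinuousOn _)

theorem IsProper.convexOn_toReal (hf : IsProper f) (hc : IsConvex f) :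
    ConvexOn ℝ (dom f) (fun x => (f x).toReal) := by
  have key : ∀ x ∈ dom f, ∀ y ∈ dom f, ∀ a b : ℝ, 0 ≤ a → 0 ≤ b → a + b = 1 →
      f (a • x + b • y) ≤ (a • (f x).toReal + b • (f y).toReal : ℝ) :=
    fun x hx y hy a b ha hb hab => hc (x := (x, (f x).toReal)) (hf.coe_toReal hx).ge
      (y := (y, (f y).toReal)) (hf.coe_toReal hy).ge ha hb hab
  have hdom : Convex ℝ (dom f) := fun x hx y hy a b ha hb hab =>
    (key x hx y hy a b ha hb hab).trans_lt (EReal.coe_lt_top _)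
  refine ⟨hdom, fun x hx y hy a b ha hb hab => EReal.coe_le_coe_iff.1 ?_⟩
  exact (hf.coe_toReal (hdom hx hy ha hb hab)).trans_le (key x hx y hy a b ha hb hab)

theorem IsProper.convexOn_toReal_add_toReal (hf : IsProper f) (hc : IsConvex f) :
    ConvexOn ℝ (dom f ×ˢ dom f) fun z => (f z.1).toReal + (f z.2).toReal :=
  have hf' := hf.convexOn_toReal hc
  have hdom := hf'.1.prod hf'.1
  ((hf'.comp_linearMap (.fst ℝ _ _)).subset (fun _ hz => hz.1) hdom).add
    ((hf'.comp_linearMap (.snd ℝ _ _)).subset (fun _ hz => hz.2) hdom)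

theorem IsProper.lowerSemicontinuousOn_toReal_add_toReal (hf : IsProper f)
    (hl : LowerSemicontinuous f) :
    LowerSemicontinuousOn (fun z => (f z.1).toReal + (f z.2).toReal) (dom f ×ˢ dom f) :=
  have hf' := hf.lowerSemicontinuousOn_toReal hl
  (hf'.comp continuousOn_fst fun _ hz => hz.1).add (hf'.comp continuousOn_snd fun _ hz => hz.2)

theorem IsProper.mem_dom_of_add_le (hf : IsProper f) {c : ℝ} (h : f x + f y ≤ c) :
    x ∈ dom f ∧ y ∈ dom f := by
  have hlt := h.trans_lt (EReal.coe_lt_top c)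
  refine ⟨mem_dom_iff.2 fun hx => ?_, mem_dom_iff.2 fun hy => ?_⟩
  · exact hlt.ne (hx ▸ EReal.top_add_of_ne_bot (hf.1 y))
  · exact hlt.ne (hy ▸ EReal.add_top_of_ne_bot (hf.1 x))

theorem IsSubmodular.toReal_le (hs : IsSubmodular f) (hf : IsProper f) (hx : x ∈ dom f)
    (hy : y ∈ dom f) : x ⊓ y ∈ dom f ∧ x ⊔ y ∈ dom f ∧
      (f (x ⊓ y)).toReal + (f (x ⊔ y)).toReal ≤ (f x).toReal + (f y).toReal := by
  have h := hs x hx y hy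
  rw [← hf.coe_toReal hx, ← hf.coe_toReal hy, ← EReal.coe_add] at h
  obtain ⟨hinf, hsup⟩ := hf.mem_dom_of_add_le h
  rw [← hf.coe_toReal hinf, ← hf.coe_toReal hsup] at h
  exact ⟨hinf, hsup, mod_cast h⟩

end Proper

theorem exists_forall_add_bilin_le {E F : Type*}
    [TopologicalSpace E] [AddCommGroup E] [Module ℝ E] [IsTopologicalAddGroup E]
    [ContinuousSMul ℝ E] [TopologicalSpace F] [AddCommGroup F] [Module ℝ F]
    [IsTopologicalAddGroup F] [ContinuousSMul ℝ F] {X : Set E} {Y : Set F}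
    {B : E →ₗ[ℝ] F →ₗ[ℝ] ℝ} (hB : ∀ x, Continuous (B x)) (hB' : ∀ y, Continuous (B.flip y))
    {g : E → ℝ} {h : F → ℝ} (ne_X : X.Nonempty) (kX : IsCompact X)
    (hg : ConvexOn ℝ X g) (hgl : LowerSemicontinuousOn g X)
    (hh : ConvexOn ℝ Y h) (hhl : LowerSemicontinuousOn h Y)
    (hex : ∀ y ∈ Y, ∃ x ∈ X, g x + B x y ≤ h y) :
    ∃ x ∈ X, ∀ y ∈ Y, g x + B x y ≤ h y := by
  have key := exists_forall_le_of_forall_exists_le (f := fun x y => g x + B x y + -h y) (t := 0)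
    ne_X kX hg.1 hh.1
    (fun y _ => (hgl.add ((hB' y).lowerSemicontinuous.lowerSemicontinuousOn X)).add
      lowerSemicontinuousOn_const)
    (fun y _ => ((hg.add ((B.flip y).convexOn hg.1)).add_const (-h y)).quasiconvexOn)
    (fun x _ => (upperSemicontinuousOn_const.add
      ((hB x).upperSemicontinuous.upperSemicontinuousOn Y)).add
        (continuous_neg.comp_lowerSemicontinuousOn_antitone hhl fun _ _ => neg_le_neg))
    (fun x _ => (((concaveOn_const (g x) hh.1).add ((B x).concaveOn hh.1)).add
      hh.neg).quasiconcaveOn)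
  simp only [← sub_eq_add_neg, sub_nonpos] at key
  exact key hex

section Conjugate

variable {ι : Type*} [Fintype ι] {f : (ι → ℝ) → EReal} {x y μ U : ι → ℝ}

theorem IsProper.conj_le_coe_iff (hf : IsProper f) {c : ℝ} :
    conj f μ ≤ c ↔ ∀ U ∈ dom f, μ ⬝ᵥ U - (f U).toReal ≤ c := by
  rw [conj, iSup_le_iff]
  refine forall_congr' fun U => ?_
  by_cases hU : U ∈ dom f
  · rw [← hf.coe_toReal hU, ← EReal.coe_sub, EReal.coe_le_coe_iff]
    simp only [hU, forall_true_left, EReal.toReal_coe, dotProduct]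
  · simp [eq_top_of_notMem_dom hU, hU]

theorem IsProper.conj_ne_bot (hf : IsProper f) (μ : ι → ℝ) : conj f μ ≠ ⊥ := by
  obtain ⟨U, hU⟩ := hf.2
  refine ne_bot_of_le_ne_bot ?_ (le_iSup _ U)
  rw [← hf.coe_toReal hU, ← EReal.coe_sub]
  exact EReal.coe_ne_bot _

theorem IsProper.isProper_conj (hf : IsProper f) (hdom : (dom (conj f)).Nonempty) :
    IsProper (conj f) :=
  ⟨hf.conj_ne_bot, hdom⟩

theorem IsProper.dotProduct_sub_le_toReal_conj (hf : IsProper f) (hμ : μ ∈ dom (conj f))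
    (hU : U ∈ dom f) : μ ⬝ᵥ U - (f U).toReal ≤ (conj f μ).toReal :=
  hf.conj_le_coe_iff.1 ((hf.isProper_conj ⟨μ, hμ⟩).coe_toReal hμ).ge U hU

theorem lowerSemicontinuous_conj : LowerSemicontinuous (conj f) := by
  refine lowerSemicontinuous_iSup fun U => Continuous.lowerSemicontinuous ?_
  refine Continuous.comp (g := fun r : ℝ => (r : EReal) - f U) ?_
    (f := fun μ : ι → ℝ => μ ⬝ᵥ U) (by fun_prop)
  induction f U using EReal.rec with
  | bot => simpa only [EReal.coe_sub_bot] using continuous_const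
  | top => simpa only [EReal.sub_top] using continuous_const
  | coe c => exact continuous_coe_real_ereal.comp (continuous_id.sub continuous_const)

theorem IsProper.isConvex_conj (hf : IsProper f) : IsConvex (conj f) := by
  intro z hz w hw a b ha hb hab
  refine hf.conj_le_coe_iff.2 fun U hU => ?_
  have hz' := mul_le_mul_of_nonneg_left (hf.conj_le_coe_iff.1 hz U hU) ha
  have hw' := mul_le_mul_of_nonneg_left (hf.conj_le_coe_iff.1 hw U hU) hb
  calc (a • z + b • w).1 ⬝ᵥ U - (f U).toReal
      = a * (z.1 ⬝ᵥ U - (f U).toReal) + b * (w.1 ⬝ᵥ U - (f U).toReal) := by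
        simp only [Prod.fst_add, Prod.smul_fst, add_dotProduct, smul_dotProduct, smul_eq_mul]
        linear_combination (f U).toReal * hab
    _ ≤ a * z.2 + b * w.2 := add_le_add hz' hw'

/-- The best response to the prices `(U, V)` loads coordinate `i` if and only if `U i < V i`. -/
theorem exists_mem_Icc_dotProduct_add_dotProduct_le {a : ι → ℝ} (hax : a ≤ x) (U V : ι → ℝ) :
    ∃ x' ∈ Set.Icc a (a ⊔ y),
      x' ⬝ᵥ U + (x + y - x') ⬝ᵥ V ≤ x ⬝ᵥ (U ⊔ V) + y ⬝ᵥ (U ⊓ V) := by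
  classical
  refine ⟨fun i => if U i < V i then (a ⊔ y) i else a i, ⟨fun i => ?_, fun i => ?_⟩, ?_⟩
  · dsimp only
    split_ifs
    exacts [le_sup_left, le_rfl]
  · dsimp only
    split_ifs
    exacts [le_rfl, le_sup_left]
  · simp only [dotProduct, ← Finset.sum_add_distrib, Pi.sub_apply, Pi.add_apply, Pi.sup_apply,
      Pi.inf_apply]
    refine Finset.sum_le_sum fun i _ => ?_
    have := hax i
    split_ifs with h
    · rw [sup_eq_right.2 h.le, inf_eq_left.2 h.le]
      nlinarith [le_sup_right (a := a i) (b := y i)]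
    · rw [sup_eq_left.2 (not_lt.1 h), inf_eq_right.2 (not_lt.1 h)]
      nlinarith

theorem IsProper.conj_add_conj_le_coe (hf : IsProper f) {c : ℝ}
    (h : ∀ U ∈ dom f, ∀ V ∈ dom f, x ⬝ᵥ U - (f U).toReal + (y ⬝ᵥ V - (f V).toReal) ≤ c) :
    conj f x + conj f y ≤ c := by
  refine iSup_add_iSup_le fun U V => ?_
  by_cases hU : U ∈ dom f
  · by_cases hV : V ∈ dom f
    · rw [← hf.coe_toReal hU, ← hf.coe_toReal hV]
      exact_mod_cast h U hU V hV
    · simp [eq_top_of_notMem_dom hV]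
  · simp [eq_top_of_notMem_dom hU]

/-- The prices of `x'` and `x + y - x'` are played against `x'` in a minimax argument. -/
theorem IsSubmodular.exists_mem_Icc_forall_dotProduct_le (hs : IsSubmodular f) (hf : IsProper f)
    (hc : IsConvex f) (hl : LowerSemicontinuous f) (hx : x ∈ dom (conj f)) (hy : y ∈ dom (conj f))
    {a : ι → ℝ} (hax : a ≤ x) :
    ∃ x' ∈ Set.Icc a (a ⊔ y), ∀ U ∈ dom f, ∀ V ∈ dom f,
      x' ⬝ᵥ U - (f U).toReal + ((x + y - x') ⬝ᵥ V - (f V).toReal)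
        ≤ (conj f x).toReal + (conj f y).toReal := by
  set c := (conj f x).toReal + (conj f y).toReal
  let L : (ι → ℝ) × (ι → ℝ) →ₗ[ℝ] ℝ := dotProductBilin ℝ ℝ (x + y) ∘ₗ .snd ℝ _ _
  let B : (ι → ℝ) →ₗ[ℝ] (ι → ℝ) × (ι → ℝ) →ₗ[ℝ] ℝ :=
    (dotProductBilin ℝ ℝ).compl₂ (.fst ℝ _ _ - .snd ℝ _ _)
  have hL (U V : ι → ℝ) : L (U, V) = x ⬝ᵥ V + y ⬝ᵥ V := add_dotProduct x y V
  have hB (x' U V : ι → ℝ) : B x' (U, V) = x' ⬝ᵥ U - x' ⬝ᵥ V := dotProduct_sub x' U V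
  let h (z : (ι → ℝ) × (ι → ℝ)) : ℝ := (f z.1).toReal + (f z.2).toReal + -L z + c
  have hhc : ConvexOn ℝ (dom f ×ˢ dom f) h := ((hf.convexOn_toReal_add_toReal hc).add
    ((-L).convexOn (hf.convexOn_toReal_add_toReal hc).1)).add_const c
  have hhl : LowerSemicontinuousOn h (dom f ×ˢ dom f) :=
    ((hf.lowerSemicontinuousOn_toReal_add_toReal hl).add
      ((-L).continuous_of_finiteDimensional.lowerSemicontinuous.lowerSemicontinuousOn _)).add
      lowerSemicontinuousOn_const
  obtain ⟨x', hx', hle⟩ := exists_forall_add_bilin_le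
    (fun z => (B z).continuous_of_finiteDimensional)
    (fun z => (B.flip z).continuous_of_finiteDimensional) (Set.nonempty_Icc.2 le_sup_left)
    isCompact_Icc (convexOn_const 0 (convex_Icc a (a ⊔ y))) lowerSemicontinuousOn_const
    hhc hhl fun ⟨U, V⟩ ⟨hU, hV⟩ => by
      obtain ⟨x', hx', hresponse⟩ := exists_mem_Icc_dotProduct_add_dotProduct_le (y := y) hax U V
      obtain ⟨hinf, hsup, hsub⟩ := hs.toReal_le hf hU hV
      have h1 := hf.dotProduct_sub_le_toReal_conj hx hsup
      have h2 := hf.dotProduct_sub_le_toReal_conj hy hinf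
      refine ⟨x', hx', ?_⟩
      simp only [sub_dotProduct, add_dotProduct] at hresponse
      simp only [h, hB, hL]
      linarith
  refine ⟨x', hx', fun U hU V hV => ?_⟩
  have := hle (U, V) ⟨hU, hV⟩
  simp only [h, hB, hL] at this
  simp only [sub_dotProduct, add_dotProduct]
  linarith

theorem IsSubmodular.exists_exchange (hs : IsSubmodular f) (hf : IsProper f) (hc : IsConvex f)
    (hl : LowerSemicontinuous f) (hx : x ∈ dom (conj f)) (hy : y ∈ dom (conj f)) {a : ι → ℝ}
    (hax : a ≤ x) :
    ∃ x' ∈ Set.Icc a (a ⊔ y), x' ∈ dom (conj f) ∧ x + y - x' ∈ dom (conj f) ∧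
      (conj f x').toReal + (conj f (x + y - x')).toReal
        ≤ (conj f x).toReal + (conj f y).toReal := by
  have hconj := hf.isProper_conj ⟨x, hx⟩
  obtain ⟨x', hx', hle⟩ := hs.exists_mem_Icc_forall_dotProduct_le hf hc hl hx hy hax
  have hsum := hf.conj_add_conj_le_coe hle
  obtain ⟨hd, hd'⟩ := hconj.mem_dom_of_add_le hsum
  rw [← hconj.coe_toReal hd, ← hconj.coe_toReal hd'] at hsum
  exact ⟨x', hx', hd, hd', mod_cast hsum⟩

end Conjugate

section ERealSums

theorem sub_coe_le_sub_coe_iff {a b : EReal} {c d : ℝ} : a - c ≤ b - d ↔ a + d ≤ b + c := by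
  rw [EReal.sub_le_iff_le_add (.inl (EReal.coe_ne_bot c)) (.inl (EReal.coe_ne_top c)),
    sub_eq_add_neg b, add_right_comm, ← sub_eq_add_neg,
    EReal.le_sub_iff_add_le (.inl (EReal.coe_ne_bot d)) (.inl (EReal.coe_ne_top d))]

theorem add_le_add_of_add_le_add {a b c d e k : EReal} (hk : k ≠ ⊥) (hk' : k ≠ ⊤)
    (h : a + k ≤ b + c) (h' : c + d ≤ k + e) : a + d ≤ b + e := by
  lift k to ℝ using ⟨hk', hk⟩
  refine (EReal.addLECancellable_coe k).add_le_add_iff_right.1 ?_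
  calc a + d + k = a + k + d := add_right_comm ..
    _ ≤ b + c + d := by gcongr
    _ = b + (c + d) := add_assoc ..
    _ ≤ b + (k + e) := by gcongr
    _ = b + e + k := by rw [add_comm (k : EReal), add_assoc]

end ERealSums

section Pairing

variable {ι : Type*} [Fintype ι] {μ ν μ' ν' : ι → ℝ} {U V U' V' : ι → EReal}

theorem pairing_coe (μ u : ι → ℝ) : pairing μ (fun i => (u i : EReal)) = (μ ⬝ᵥ u : ℝ) :=
  (map_sum (⟨⟨(↑), EReal.coe_zero⟩, EReal.coe_add⟩ : ℝ →+ EReal) (fun i => μ i * u i) _).symm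

theorem pairing_zero (U : ι → EReal) : pairing 0 U = 0 := by
  simp [pairing]

theorem pairing_mono (hμ : 0 ≤ μ) (hUV : U ≤ V) : pairing μ U ≤ pairing μ V :=
  Finset.sum_le_sum fun i _ => mul_le_mul_of_nonneg_left (hUV i) (EReal.coe_nonneg.2 (hμ i))

theorem pairing_ne_top (hμ : 0 ≤ μ) (hU : ∀ i, U i ≠ ⊤) : pairing μ U ≠ ⊤ := by
  refine ne_top_of_le_ne_top ?_ (pairing_mono hμ fun i => EReal.le_coe_toReal (hU i))
  exact pairing_coe μ _ ▸ EReal.coe_ne_top _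

theorem pairing_add_pairing_le
    (h : ∀ i, (μ i * U i + ν i * V i : EReal) ≤ μ' i * U' i + ν' i * V' i) :
    pairing μ U + pairing ν V ≤ pairing μ' U' + pairing ν' V' := by
  simp only [pairing, ← Finset.sum_add_distrib]
  exact Finset.sum_le_sum fun i _ => h i

theorem objective_eq (G : (ι → ℝ) → EReal) (α μ : ι → ℝ) :
    objective G α μ = pairing μ (fun i => (α i : EReal)) - conj G μ := by
  rw [pairing_coe, objective, dotProduct]

end Pairing

section Welfare

variable {ι : Type*} [Fintype ι] {G : (ι → ℝ) → EReal} {μ ν : ι → ℝ} {U V : ι → EReal}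

theorem IsWelfare.isProper_conj (hG : IsWelfare G) : IsProper (conj G) :=
  hG.proper.isProper_conj ⟨0, hG.isLeast_zero.1⟩

theorem IsWelfare.coe_toReal_conj (hG : IsWelfare G) (hμ : μ ∈ dom (conj G)) :
    ((conj G μ).toReal : EReal) = conj G μ :=
  hG.isProper_conj.coe_toReal hμ

theorem IsWelfare.nonneg (hG : IsWelfare G) (hμ : μ ∈ dom (conj G)) : 0 ≤ μ :=
  hG.isLeast_zero.2 hμ

theorem IsWelfare.ext_mono (hG : IsWelfare G) (hUV : U ≤ V) : ext G U ≤ ext G V := by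
  refine iSup_mono fun ν => ?_
  by_cases hν : ν ∈ dom (conj G)
  · exact EReal.sub_le_sub (pairing_mono (hG.nonneg hν) hUV) le_rfl
  · simp [eq_top_of_notMem_dom hν]

theorem IsWelfare.ext_ne_bot (hG : IsWelfare G) (U : ι → EReal) : ext G U ≠ ⊥ := by
  refine ne_bot_of_le_ne_bot ?_ (le_iSup _ 0)
  rw [pairing_zero, zero_sub, Ne, EReal.neg_eq_bot_iff]
  exact mem_dom_iff.1 hG.isLeast_zero.1

theorem upperSemicontinuous_objective (G : (ι → ℝ) → EReal) (α : ι → ℝ) :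
    UpperSemicontinuous (objective G α) := by
  refine UpperSemicontinuous.add' (f := fun μ => ((μ ⬝ᵥ α : ℝ) : EReal))
    (Continuous.upperSemicontinuous ?_)
    (continuous_neg.comp_lowerSemicontinuous_antitone lowerSemicontinuous_conj
      fun _ _ => EReal.neg_le_neg_iff.2) fun μ =>
    EReal.continuousAt_add (.inl (EReal.coe_ne_top _)) (.inl (EReal.coe_ne_bot _))
  exact continuous_coe_real_ereal.comp (by fun_prop)

theorem IsWelfare.coe_objective (hG : IsWelfare G) (hμ : μ ∈ dom (conj G)) (α : ι → ℝ) :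
    objective G α μ = (μ ⬝ᵥ α - (conj G μ).toReal : ℝ) := by
  rw [objective, ← hG.coe_toReal_conj hμ, ← EReal.coe_sub]
  rfl

theorem objective_eq_bot_of_notMem_dom (hμ : μ ∉ dom (conj G)) (α : ι → ℝ) :
    objective G α μ = ⊥ := by
  rw [objective, eq_top_of_notMem_dom hμ, EReal.sub_top]

theorem IsWelfare.argmaxOn_objective_nonempty (hG : IsWelfare G) {S : Set (ι → ℝ)}
    (hS : IsClosed S) (h0 : 0 ∈ S) (α : ι → ℝ) : (argmaxOn S (objective G α)).Nonempty := by
  obtain ⟨μ, hμ, hbot, hmax⟩ := argmaxOn_nonempty (hG.compact_dom.inter_right hS)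
    ((upperSemicontinuous_objective G α).upperSemicontinuousOn _) ⟨hG.isLeast_zero.1, h0⟩
    (hG.coe_objective hG.isLeast_zero.1 α ▸ EReal.coe_ne_bot _)
  refine ⟨μ, hμ.2, hbot, fun ν hν => ?_⟩
  by_cases hνdom : ν ∈ dom (conj G)
  · exact hmax ν ⟨hνdom, hν⟩
  · exact objective_eq_bot_of_notMem_dom hνdom α ▸ bot_le

theorem IsWelfare.mem_argmaxOn_objective_iff (hG : IsWelfare G) {S : Set (ι → ℝ)} {α : ι → ℝ} :
    μ ∈ argmaxOn S (objective G α) ↔ μ ∈ S ∧ μ ∈ dom (conj G) ∧ ∀ ν ∈ S, ν ∈ dom (conj G) →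
      ν ⬝ᵥ α - (conj G ν).toReal ≤ μ ⬝ᵥ α - (conj G μ).toReal := by
  refine and_congr_right fun _ => ⟨fun ⟨hbot, hmax⟩ => ?_, fun ⟨hμ, hmax⟩ => ⟨?_, fun ν hν => ?_⟩⟩
  · have hμ : μ ∈ dom (conj G) := not_imp_comm.1 (objective_eq_bot_of_notMem_dom · α) hbot
    refine ⟨hμ, fun ν hν hνdom => EReal.coe_le_coe_iff.1 ?_⟩
    rw [← hG.coe_objective hνdom, ← hG.coe_objective hμ]
    exact hmax ν hν
  · exact hG.coe_objective hμ α ▸ EReal.coe_ne_bot _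
  · by_cases hνdom : ν ∈ dom (conj G)
    · rw [hG.coe_objective hνdom, hG.coe_objective hμ]
      exact EReal.coe_le_coe (hmax ν hν hνdom)
    · exact objective_eq_bot_of_notMem_dom hνdom α ▸ bot_le

theorem IsWelfare.exists_ext_coe_eq (hG : IsWelfare G) (u : ι → ℝ) :
    ∃ μ ∈ dom (conj G), ext G (fun i => (u i : EReal)) = objective G u μ := by
  obtain ⟨μ, hμ⟩ := hG.argmaxOn_objective_nonempty isClosed_univ (Set.mem_univ 0) u
  refine ⟨μ, (hG.mem_argmaxOn_objective_iff.1 hμ).2.1, le_antisymm (iSup_le fun ν => ?_) ?_⟩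
  · exact objective_eq G u ν ▸ hμ.2.2 ν (Set.mem_univ ν)
  · exact objective_eq G u μ ▸ le_iSup (fun ν => pairing ν _ - conj G ν) μ

theorem IsWelfare.ext_ne_top (hG : IsWelfare G) (hU : ∀ i, U i ≠ ⊤) : ext G U ≠ ⊤ := by
  refine ne_top_of_le_ne_top ?_ (hG.ext_mono fun i => EReal.le_coe_toReal (hU i))
  obtain ⟨μ, hμ, heq⟩ := hG.exists_ext_coe_eq fun i => (U i).toReal
  rw [heq, hG.coe_objective hμ]
  exact EReal.coe_ne_top _

theorem IsWelfare.pairing_le_conj_add_ext (hG : IsWelfare G) (ν : ι → ℝ) (U : ι → EReal) :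
    pairing ν U ≤ conj G ν + ext G U := by
  rw [add_comm]
  exact (EReal.sub_le_iff_le_add (.inl (hG.isProper_conj.1 ν)) (.inr (hG.ext_ne_bot U))).1
    (le_iSup (fun μ => pairing μ U - conj G μ) ν)

theorem IsWelfare.mem_subdiff_iff_conj_add_ext_le (hG : IsWelfare G) :
    μ ∈ subdiff G U ↔ μ ∈ dom (conj G) ∧ conj G μ + ext G U ≤ pairing μ U :=
  and_congr_right fun _ => ⟨le_of_eq, fun h => h.antisymm (hG.pairing_le_conj_add_ext μ U)⟩

theorem IsWelfare.mem_subdiff_iff_forall (hG : IsWelfare G) :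
    μ ∈ subdiff G U ↔ μ ∈ dom (conj G) ∧
      ∀ ν ∈ dom (conj G), pairing ν U + conj G μ ≤ pairing μ U + conj G ν := by
  rw [hG.mem_subdiff_iff_conj_add_ext_le]
  refine and_congr_right fun hμ => ?_
  rw [← hG.coe_toReal_conj hμ, add_comm, ← EReal.le_sub_iff_add_le (.inl (EReal.coe_ne_bot _))
    (.inl (EReal.coe_ne_top _)), ext, iSup_le_iff]
  refine forall_congr' fun ν => ?_
  by_cases hν : ν ∈ dom (conj G)
  · rw [← hG.coe_toReal_conj hν, sub_coe_le_sub_coe_iff]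
    exact (imp_iff_right hν).symm
  · simp [eq_top_of_notMem_dom hν, hν]

theorem IsWelfare.pairing_ne_bot_of_mem_subdiff (hG : IsWelfare G) (hμ : μ ∈ subdiff G U) :
    pairing μ U ≠ ⊥ := by
  rw [← hμ.2]
  exact EReal.add_ne_bot_iff.2 ⟨hG.isProper_conj.1 μ, hG.ext_ne_bot U⟩

/-- Raising prices where `μ` is maximal over the domain favours `μ` over all competitors. -/
theorem IsWelfare.mem_subdiff_of_le (hG : IsWelfare G) (hμ : μ ∈ subdiff G U)
    (hU : ∀ i, U i ≠ ⊤) (hUV : U ≤ V) (hmax : ∀ i, U i ≠ V i → ∀ ν ∈ dom (conj G), ν i ≤ μ i) :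
    μ ∈ subdiff G V := by
  have hμ' := hG.mem_subdiff_iff_forall.1 hμ
  refine hG.mem_subdiff_iff_forall.2 ⟨hμ.1, fun ν hν => ?_⟩
  refine add_le_add_of_add_le_add (hG.pairing_ne_bot_of_mem_subdiff hμ)
    (pairing_ne_top (hG.nonneg hμ.1) hU) (pairing_add_pairing_le fun i => ?_) (hμ'.2 ν hν)
  rcases eq_or_ne (U i) (V i) with h | h
  · rw [h, add_comm]
  · rw [add_comm (μ i * V i : EReal)]
    exact mul_add_mul_le_of_rearrange (hG.nonneg hν i) (hG.nonneg hν i) rfl (hmax i h ν hν) (hUV i)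

end Welfare

section ExtSubmodular

variable {ι : Type*} [Fintype ι] {G : (ι → ℝ) → EReal} {μ : ι → ℝ} {U V : ι → EReal}

theorem IsWelfare.pairing_sub_conj_add_le (hG : IsWelfare G) (hs : IsSubmodular G) {x y : ι → ℝ}
    (hx : x ∈ dom (conj G)) (hy : y ∈ dom (conj G)) (U V : ι → EReal) :
    pairing x (U ⊔ V) - conj G x + (pairing y (U ⊓ V) - conj G y) ≤ ext G U + ext G V := by
  classical
  let a (i : ι) : ℝ := if U i < V i then (x ⊓ y) i else x i
  have hax : a ≤ x := fun i => by
    dsimp only [a]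
    split_ifs
    exacts [inf_le_left, le_rfl]
  obtain ⟨x', ⟨hax', hx'⟩, hd, hd', hle⟩ :=
    hs.exists_exchange hG.proper hG.convex hG.lsc hx hy hax
  have hpairing : pairing x (U ⊔ V) + pairing y (U ⊓ V) ≤
      pairing x' U + pairing (x + y - x') V := by
    refine pairing_add_pairing_le fun i => ?_
    have hx'0 := hG.nonneg hd i
    have hy'0 := hG.nonneg hd' i
    replace hx' := hx' i
    replace hax' := hax' i
    rcases lt_or_ge (U i) (V i) with h | h
    · rw [Pi.sup_apply, sup_eq_right.2 h.le, Pi.inf_apply, inf_eq_left.2 h.le]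
      simp only [Pi.sup_apply, a, if_pos h, Pi.inf_apply, inf_le_right, sup_of_le_right] at hx'
      exact mul_add_mul_le_of_rearrange (hG.nonneg hx i) hx'0
        (add_sub_cancel (x' i) (x i + y i)).symm hx' h.le
    · rw [Pi.sup_apply, sup_eq_left.2 h, Pi.inf_apply, inf_eq_right.2 h,
        add_comm (x' i * U i : EReal)]
      simp only [a, if_neg h.not_gt] at hax'
      refine mul_add_mul_le_of_rearrange (hG.nonneg hx i) hy'0
        (sub_add_cancel (x i + y i) (x' i)).symm ?_ h
      simp only [Pi.sub_apply, Pi.add_apply]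
      linarith
  calc pairing x (U ⊔ V) - conj G x + (pairing y (U ⊓ V) - conj G y)
      ≤ pairing x' U - conj G x' + (pairing (x + y - x') V - conj G (x + y - x')) := by
        rw [← hG.coe_toReal_conj hx, ← hG.coe_toReal_conj hy, ← hG.coe_toReal_conj hd,
          ← hG.coe_toReal_conj hd', sub_coe_add_sub_coe, sub_coe_add_sub_coe]
        exact EReal.sub_le_sub hpairing (EReal.coe_le_coe hle)
    _ ≤ ext G U + ext G V := add_le_add (le_iSup (fun ν => pairing ν U - conj G ν) x')
        (le_iSup (fun ν => pairing ν V - conj G ν) (x + y - x'))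

theorem IsWelfare.ext_sup_add_ext_inf_le (hG : IsWelfare G) (hs : IsSubmodular G)
    (U V : ι → EReal) : ext G (U ⊔ V) + ext G (U ⊓ V) ≤ ext G U + ext G V := by
  refine iSup_add_iSup_le fun x y => ?_
  by_cases hx : x ∈ dom (conj G)
  · by_cases hy : y ∈ dom (conj G)
    · exact hG.pairing_sub_conj_add_le hs hx hy U V
    · simp [eq_top_of_notMem_dom hy]
  · simp [eq_top_of_notMem_dom hx]

end ExtSubmodular

section Semicontinuity

theorem upperSemicontinuousOn_finset_sum {X κ : Type*} [TopologicalSpace X] {s : Set X}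
    {f : κ → X → EReal} {t : Finset κ} (hf : ∀ i ∈ t, UpperSemicontinuousOn (f i) s)
    (htop : ∀ i ∈ t, ∀ x ∈ s, f i x ≠ ⊤) :
    UpperSemicontinuousOn (fun x => ∑ i ∈ t, f i x) s := by
  simp only [← Finset.sum_apply]
  refine (Finset.sum_induction f (fun g => UpperSemicontinuousOn g s ∧ ∀ x ∈ s, g x ≠ ⊤)
    (fun g h hg hh => ⟨hg.1.add' hh.1 fun x hx => ?_, fun x hx => ?_⟩)
    ⟨upperSemicontinuousOn_const, fun _ _ => EReal.zero_ne_top⟩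
    fun i hi => ⟨hf i hi, htop i hi⟩).1
  · exact EReal.continuousAt_add (.inl (hg.2 x hx)) (.inr (hh.2 x hx))
  · exact EReal.add_ne_top (hg.2 x hx) (hh.2 x hx)

theorem lowerSemicontinuousOn_finset_sum {X κ : Type*} [TopologicalSpace X] {s : Set X}
    {f : κ → X → EReal} {t : Finset κ} (hf : ∀ i ∈ t, LowerSemicontinuousOn (f i) s)
    (htop : ∀ i ∈ t, ∀ x ∈ s, f i x ≠ ⊤) :
    LowerSemicontinuousOn (fun x => ∑ i ∈ t, f i x) s := by
  simp only [← Finset.sum_apply]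
  refine (Finset.sum_induction f (fun g => LowerSemicontinuousOn g s ∧ ∀ x ∈ s, g x ≠ ⊤)
    (fun g h hg hh => ⟨hg.1.add' hh.1 fun x hx => ?_, fun x hx => ?_⟩)
    ⟨lowerSemicontinuousOn_const, fun _ _ => EReal.zero_ne_top⟩
    fun i hi => ⟨hf i hi, htop i hi⟩).1
  · exact EReal.continuousAt_add (.inl (hg.2 x hx)) (.inr (hh.2 x hx))
  · exact EReal.add_ne_top (hg.2 x hx) (hh.2 x hx)

theorem coe_mul_ne_top {a : ℝ} {u : EReal} (ha : 0 ≤ a) (hu : u ≠ ⊤) : (a * u : EReal) ≠ ⊤ := by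
  refine ne_top_of_le_ne_top (EReal.coe_ne_top (a * u.toReal)) ?_
  rw [EReal.coe_mul]
  exact mul_le_mul_of_nonneg_left (EReal.le_coe_toReal hu) (EReal.coe_nonneg.2 ha)

/-- With the convention `0 * ⊥ = 0`, the product is not continuous at `(0, ⊥)`. -/
theorem upperSemicontinuousOn_coe_mul :
    UpperSemicontinuousOn (fun p : ℝ × EReal => (p.1 * p.2 : EReal)) (Set.Ici 0 ×ˢ {⊤}ᶜ) := by
  rintro ⟨a, u⟩ ⟨ha, hu⟩
  by_cases hau : a = 0 ∧ u = ⊥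
  · obtain ⟨rfl, rfl⟩ := hau
    intro c hc
    have hneg : ∀ᶠ p : ℝ × EReal in 𝓝 (0, ⊥), p.2 < 0 :=
      continuous_snd.continuousAt.eventually_lt_const EReal.bot_lt_zero
    filter_upwards [nhdsWithin_le_nhds hneg, self_mem_nhdsWithin] with p hp hps
    simp only [EReal.coe_zero, zero_mul] at hc
    exact (mul_nonpos_of_nonneg_of_nonpos (EReal.coe_nonneg.2 hps.1) hp.le).trans_lt hc
  · have hmul : ContinuousAt (fun p : EReal × EReal => p.1 * p.2) ((a : EReal), u) := by
      refine EReal.continuousAt_mul ?_ (.inr hu) (.inl (EReal.coe_ne_bot a))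
        (.inl (EReal.coe_ne_top a))
      exact (not_and_or.1 hau).imp (fun h => EReal.coe_ne_zero.2 h) id
    have hcoe : ContinuousAt (fun p : ℝ × EReal => ((p.1 : EReal), p.2)) (a, u) :=
      ((continuous_coe_real_ereal.comp continuous_fst).prodMk continuous_snd).continuousAt
    have hcomp := ContinuousAt.comp (x := (a, u)) (g := fun p : EReal × EReal => p.1 * p.2)
      (f := fun p : ℝ × EReal => ((p.1 : EReal), p.2)) hmul hcoe
    exact hcomp.upperSemicontinuousAt.upperSemicontinuousWithinAt _

variable {ι : Type*} [Fintype ι] {G : (ι → ℝ) → EReal} {μ : ι → ℝ} {U : ι → EReal}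

theorem upperSemicontinuousOn_pairing : UpperSemicontinuousOn
    (fun p : (ι → ℝ) × (ι → EReal) => pairing p.1 p.2) (Set.Ici 0 ×ˢ {U | ∀ i, U i ≠ ⊤}) :=
  upperSemicontinuousOn_finset_sum
    (fun i _ => upperSemicontinuousOn_coe_mul.comp
      (g := fun p : (ι → ℝ) × (ι → EReal) => (p.1 i, p.2 i))
      (Continuous.continuousOn (by fun_prop)) fun _ hp => ⟨hp.1 i, hp.2 i⟩)
    fun i _ _ hp => coe_mul_ne_top (hp.1 i) (hp.2 i)

theorem lowerSemicontinuousOn_pairing (hμ : 0 ≤ μ) :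
    LowerSemicontinuousOn (pairing μ) {U | ∀ i, U i ≠ ⊤} := by
  refine lowerSemicontinuousOn_finset_sum (fun i _ => ?_) fun i _ _ hU =>
    coe_mul_ne_top (hμ i) (hU i)
  refine (continuous_iff_continuousAt.2 fun U => ?_).lowerSemicontinuous.lowerSemicontinuousOn _
  exact EReal.Tendsto.const_mul (continuous_apply i).continuousAt
    (.inl (EReal.coe_ne_bot _)) (.inl (EReal.coe_ne_top _))

theorem IsWelfare.lowerSemicontinuousOn_ext (hG : IsWelfare G) :
    LowerSemicontinuousOn (ext G) {U | ∀ i, U i ≠ ⊤} := by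
  refine lowerSemicontinuousOn_iSup fun ν => ?_
  by_cases hν : ν ∈ dom (conj G)
  · refine (lowerSemicontinuousOn_pairing (hG.nonneg hν)).add' lowerSemicontinuousOn_const
      fun U hU => EReal.continuousAt_add (.inl (pairing_ne_top (hG.nonneg hν) hU)) (.inr ?_)
    exact EReal.neg_eq_top_iff.not.2 (hG.isProper_conj.1 ν)
  · simpa only [eq_top_of_notMem_dom hν, EReal.sub_top] using lowerSemicontinuousOn_const

theorem IsWelfare.lowerSemicontinuousOn_conj_add_ext (hG : IsWelfare G) :
    LowerSemicontinuousOn (fun p : (ι → ℝ) × (ι → EReal) => conj G p.1 + ext G p.2)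
      (dom (conj G) ×ˢ {U | ∀ i, U i ≠ ⊤}) := by
  refine LowerSemicontinuousOn.add'
    (f := fun p : (ι → ℝ) × (ι → EReal) => conj G p.1)
    (g := fun p : (ι → ℝ) × (ι → EReal) => ext G p.2)
    ((lowerSemicontinuous_conj.lowerSemicontinuousOn (dom (conj G))).comp
      continuousOn_fst fun p hp => hp.1)
    (hG.lowerSemicontinuousOn_ext.comp continuousOn_snd fun p hp => hp.2) fun p hp => ?_
  exact EReal.continuousAt_add (.inl (mem_dom_iff.1 hp.1)) (.inl (hG.isProper_conj.1 _))

theorem IsWelfare.mem_subdiff_of_tendsto (hG : IsWelfare G) {κ : Type*} {l : Filter κ} [l.NeBot]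
    {m : κ → ι → ℝ} {u : κ → ι → EReal} (hm : Tendsto m l (𝓝 μ)) (hu : Tendsto u l (𝓝 U))
    (hU : ∀ i, U i ≠ ⊤) (hutop : ∀ k i, u k i ≠ ⊤) (hmem : ∀ k, m k ∈ subdiff G (u k)) :
    μ ∈ subdiff G U := by
  have hμ : μ ∈ dom (conj G) :=
    hG.compact_dom.isClosed.mem_of_tendsto hm (.of_forall fun k => (hmem k).1)
  refine hG.mem_subdiff_iff_conj_add_ext_le.2 ⟨hμ, le_of_not_gt fun hlt => ?_⟩
  obtain ⟨c, hc, hc'⟩ := exists_between hlt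
  have hlim : Tendsto (fun k => (m k, u k)) l (𝓝[dom (conj G) ×ˢ {U | ∀ i, U i ≠ ⊤}] (μ, U)) :=
    tendsto_nhdsWithin_iff.2 ⟨hm.prodMk_nhds hu, .of_forall fun k => ⟨(hmem k).1, hutop k⟩⟩
  have husc : UpperSemicontinuousOn (fun p : (ι → ℝ) × (ι → EReal) => pairing p.1 p.2)
      (dom (conj G) ×ˢ {U | ∀ i, U i ≠ ⊤}) :=
    upperSemicontinuousOn_pairing.mono (Set.prod_mono_left fun _ => hG.nonneg)
  have hpairing : ∀ᶠ k in l, pairing (m k) (u k) < c := hlim (husc (μ, U) ⟨hμ, hU⟩ c hc)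
  have hsum : ∀ᶠ k in l, c < conj G (m k) + ext G (u k) :=
    hlim (hG.lowerSemicontinuousOn_conj_add_ext (μ, U) ⟨hμ, hU⟩ c hc')
  obtain ⟨k, hk, hk'⟩ := (hpairing.and hsum).exists
  exact (hk.trans hk').ne' (hmem k).2

end Semicontinuity

section Reduce

variable {ι : Type*} {α : ι → ℝ} {τ τ' : ι → EReal}

theorem reduce_coe (s : ι → ℝ) :
    reduce α (fun i => (s i : EReal)) = fun i => ((α - s) i : EReal) :=
  rfl

theorem reduce_zero : reduce α 0 = fun i => (α i : EReal) := by
  funext i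
  simp [reduce]

theorem reduce_antitone : Antitone (reduce α) :=
  fun _ _ h i => EReal.sub_le_sub le_rfl (h i)

theorem reduce_ne_top (hτ : 0 ≤ τ) (i : ι) : reduce α τ i ≠ ⊤ := by
  refine ne_top_of_le_ne_top (EReal.coe_ne_top (α i)) ?_
  simpa only [reduce_zero] using reduce_antitone hτ i

theorem reduce_inf : reduce α (τ ⊓ τ') = reduce α τ ⊔ reduce α τ' :=
  funext fun i => Antitone.map_inf (f := fun t : EReal => (α i : EReal) - t)
    (fun _ _ h => EReal.sub_le_sub le_rfl h) (τ i) (τ' i)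

theorem reduce_sup : reduce α (τ ⊔ τ') = reduce α τ ⊓ reduce α τ' :=
  funext fun i => Antitone.map_sup (f := fun t : EReal => (α i : EReal) - t)
    (fun _ _ h => EReal.sub_le_sub le_rfl h) (τ i) (τ' i)

theorem continuous_reduce : Continuous (reduce α) := by
  refine continuous_pi fun i => continuous_iff_continuousAt.2 fun τ => ?_
  have hadd := EReal.continuousAt_add (p := ((α i : EReal), -τ i))
    (.inl (EReal.coe_ne_top _)) (.inl (EReal.coe_ne_bot _))
  exact hadd.comp (f := fun τ : ι → EReal => ((α i : EReal), -τ i)) (x := τ)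
    (continuousAt_const.prodMk (continuous_neg.comp (continuous_apply i)).continuousAt)

end Reduce

section Multipliers

variable {ι : Type*} [Fintype ι] {G : (ι → ℝ) → EReal} {α A A' μ : ι → ℝ} {τ τ' : ι → EReal}

theorem IsWelfare.coe_toReal_ext_reduce (hG : IsWelfare G) (hτ : 0 ≤ τ) :
    ((ext G (reduce α τ)).toReal : EReal) = ext G (reduce α τ) :=
  EReal.coe_toReal (hG.ext_ne_top (reduce_ne_top hτ)) (hG.ext_ne_bot _)

theorem IsWelfare.pairing_sub_ext_reduce_zero_ne_bot (hG : IsWelfare G) (α A : ι → ℝ) :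
    pairing A (reduce α 0) - ext G (reduce α 0) ≠ ⊥ := by
  rw [← hG.coe_toReal_ext_reduce le_rfl, reduce_zero, pairing_coe, ← EReal.coe_sub]
  exact EReal.coe_ne_bot _

theorem IsWelfare.mem_multipliers_iff (hG : IsWelfare G) :
    τ ∈ multipliers G α A ↔ 0 ≤ τ ∧ ∀ σ, 0 ≤ σ →
      pairing A (reduce α σ) + ext G (reduce α τ) ≤
        pairing A (reduce α τ) + ext G (reduce α σ) := by
  have hobj : ∀ σ, 0 ≤ σ → 0 ≤ τ → (pairing A (reduce α σ) - ext G (reduce α σ) ≤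
      pairing A (reduce α τ) - ext G (reduce α τ) ↔ pairing A (reduce α σ) + ext G (reduce α τ) ≤
        pairing A (reduce α τ) + ext G (reduce α σ)) := fun σ hσ hτ => by
    rw [← hG.coe_toReal_ext_reduce hσ, ← hG.coe_toReal_ext_reduce hτ, sub_coe_le_sub_coe_iff]
  exact ⟨fun h => ⟨h.1, fun σ hσ => (hobj σ hσ h.1).1 (h.2.2 σ hσ)⟩, fun ⟨hτ, h⟩ =>
    ⟨hτ, ne_bot_of_le_ne_bot (hG.pairing_sub_ext_reduce_zero_ne_bot α A)
      ((hobj 0 le_rfl hτ).2 (h 0 le_rfl)),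
      fun σ hσ => (hobj σ hσ hτ).2 (h σ hσ)⟩⟩

theorem IsWelfare.pairing_reduce_ne_bot (hG : IsWelfare G) (hτ : τ ∈ multipliers G α A) :
    pairing A (reduce α τ) ≠ ⊥ := by
  have h := (hG.mem_multipliers_iff.1 hτ).2 0 le_rfl
  intro hbot
  rw [hbot, EReal.bot_add, le_bot_iff, EReal.add_eq_bot_iff, reduce_zero, pairing_coe] at h
  exact h.elim (EReal.coe_ne_bot _) (hG.ext_ne_bot _)

theorem IsWelfare.inf_mem_multipliers (hG : IsWelfare G) (hs : IsSubmodular G) (hA' : 0 ≤ A')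
    (hAA' : A' ≤ A) (hτ : τ ∈ multipliers G α A) (hτ' : τ' ∈ multipliers G α A') :
    τ ⊓ τ' ∈ multipliers G α A := by
  obtain ⟨hτ0, hmax⟩ := hG.mem_multipliers_iff.1 hτ
  obtain ⟨hτ'0, hmax'⟩ := hG.mem_multipliers_iff.1 hτ'
  set R := reduce α τ
  set R' := reduce α τ'
  have hinf : pairing A' (R ⊓ R') + ext G R' ≤ pairing A' R' + ext G (R ⊓ R') :=
    reduce_sup (α := α) ▸ hmax' (τ ⊔ τ') (hτ0.trans le_sup_left)
  have hsubmod : ext G (R ⊓ R') + ext G (R ⊔ R') ≤ ext G R' + ext G R := by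
    rw [add_comm, add_comm (ext G R')]
    exact hG.ext_sup_add_ext_inf_le hs R R'
  have hrearrange : pairing A R + pairing A' R' ≤ pairing A (R ⊔ R') + pairing A' (R ⊓ R') := by
    refine pairing_add_pairing_le fun i => ?_
    rcases le_total (R i) (R' i) with h | h
    · rw [Pi.sup_apply, sup_eq_right.2 h, Pi.inf_apply, inf_eq_left.2 h,
        add_comm (A i * R i : EReal), add_comm (A i * R' i : EReal)]
      exact mul_add_mul_le_of_rearrange (hA' i) (hA' i) rfl (hAA' i) h
    · rw [Pi.sup_apply, sup_eq_left.2 h, Pi.inf_apply, inf_eq_right.2 h]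
  have hsup : pairing A R + ext G (R ⊔ R') ≤ pairing A (R ⊔ R') + ext G R :=
    add_le_add_of_add_le_add (hG.pairing_reduce_ne_bot hτ')
      (pairing_ne_top hA' (reduce_ne_top hτ'0)) hrearrange
      (add_le_add_of_add_le_add (hG.ext_ne_bot R') (hG.ext_ne_top (reduce_ne_top hτ'0))
        hinf hsubmod)
  refine hG.mem_multipliers_iff.2 ⟨le_inf hτ0 hτ'0, fun σ hσ => ?_⟩
  rw [reduce_inf, add_comm (pairing A (R ⊔ R'))]
  exact add_le_add_of_add_le_add (hG.ext_ne_bot R) (hG.ext_ne_top (reduce_ne_top hτ0))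
    ((hmax σ hσ).trans_eq (add_comm _ _)) (hsup.trans_eq (add_comm _ _))

theorem IsWelfare.upperSemicontinuousOn_pairing_sub_ext (hG : IsWelfare G) (hA : 0 ≤ A) :
    UpperSemicontinuousOn (fun τ => pairing A (reduce α τ) - ext G (reduce α τ)) {τ | 0 ≤ τ} := by
  refine UpperSemicontinuousOn.add' (f := fun τ => pairing A (reduce α τ))
    (g := fun τ => -ext G (reduce α τ))
    (upperSemicontinuousOn_pairing.comp (g := fun τ => (A, reduce α τ))
      (continuous_const.prodMk continuous_reduce).continuousOn
      fun τ hτ => ⟨hA, reduce_ne_top hτ⟩)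
    (continuous_neg.comp_lowerSemicontinuousOn_antitone (hG.lowerSemicontinuousOn_ext.comp
      continuous_reduce.continuousOn fun τ hτ => reduce_ne_top hτ)
      fun _ _ => EReal.neg_le_neg_iff.2) fun τ hτ => ?_
  exact EReal.continuousAt_add (.inl (pairing_ne_top hA (reduce_ne_top hτ)))
    (.inr (EReal.neg_eq_top_iff.not.2 (hG.ext_ne_bot _)))

theorem IsWelfare.isLeast_leastMultiplier (hG : IsWelfare G) (hs : IsSubmodular G) (hA : 0 ≤ A) :
    IsLeast (multipliers G α A) (leastMultiplier G α A) := by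
  have husc := hG.upperSemicontinuousOn_pairing_sub_ext (α := α) hA
  have hclosed : IsClosed {τ : ι → EReal | 0 ≤ τ} := isClosed_Ici
  exact isLeast_sInf_of_infClosed
    (fun τ hτ τ' hτ' => hG.inf_mem_multipliers hs hA le_rfl hτ hτ')
    (argmaxOn_nonempty hclosed.isCompact husc (x := 0) (Set.self_mem_Ici (a := 0))
      (hG.pairing_sub_ext_reduce_zero_ne_bot α A)) (isClosed_argmaxOn hclosed husc)

theorem IsWelfare.leastMultiplier_le_of_le (hG : IsWelfare G) (hs : IsSubmodular G)
    (hA' : 0 ≤ A') (hAA' : A' ≤ A) : leastMultiplier G α A ≤ leastMultiplier G α A' :=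
  ((hG.isLeast_leastMultiplier hs (hA'.trans hAA')).2 (hG.inf_mem_multipliers hs hA' hAA'
    (hG.isLeast_leastMultiplier hs (hA'.trans hAA')).1
    (hG.isLeast_leastMultiplier hs hA').1)).trans inf_le_right

theorem IsWelfare.mem_multipliers_of_mem_subdiff (hG : IsWelfare G) (hτ : 0 ≤ τ)
    (hμ : μ ∈ subdiff G (reduce α τ)) : τ ∈ multipliers G α μ := by
  refine hG.mem_multipliers_iff.2 ⟨hτ, fun σ _ => ?_⟩
  rw [← hμ.2, add_right_comm]
  exact add_le_add_left (hG.pairing_le_conj_add_ext μ _) _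

end Multipliers

section Disposals

variable {ι : Type*} [Fintype ι] {G : (ι → ℝ) → EReal} {α A A' T P Q : ι → ℝ}

theorem IsWelfare.disposals_nonempty (hG : IsWelfare G) (hA : 0 ≤ A) (α : ι → ℝ) :
    (disposals G α A).Nonempty :=
  hG.argmaxOn_objective_nonempty isClosed_Iic hA α

theorem mem_proposals_of_mem_disposals (hQ : Q ∈ disposals G α A) (hTQ : T ≤ Q) :
    Q ∈ proposals G α T A :=
  argmaxOn_inter_subset (fun _ hμ => hμ.2) ⟨hQ, hTQ, hQ.1⟩

theorem mem_disposals_of_mem_proposals (hQ : Q ∈ disposals G α A) (hTQ : T ≤ Q)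
    (hP : P ∈ proposals G α T A) : P ∈ disposals G α A :=
  have hQP := hP.2.2 Q ⟨hTQ, hQ.1⟩
  ⟨hP.1.2, hP.2.1, fun μ hμ => (hQ.2.2 μ hμ).trans hQP⟩

theorem IsWelfare.exists_mem_disposals_ge (hG : IsWelfare G) (hs : IsSubmodular G)
    (hP : P ∈ disposals G α A) (hTP : T ≤ P) (hTA' : T ≤ A') (hA' : 0 ≤ A') (hA'A : A' ≤ A) :
    ∃ Q ∈ disposals G α A', T ≤ Q := by
  obtain ⟨Q, hQ⟩ := hG.disposals_nonempty hA' α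
  obtain ⟨hPA, hPdom, hPmax⟩ := hG.mem_argmaxOn_objective_iff.1 hP
  obtain ⟨hQA', hQdom, hQmax⟩ := hG.mem_argmaxOn_objective_iff.1 hQ
  obtain ⟨P', ⟨hle, hge⟩, hP'dom, hQ'dom, hexchange⟩ := hs.exists_exchange hG.proper hG.convex
    hG.lsc hPdom hQdom (a := P ⊓ (P + Q - T)) inf_le_left
  have hP'A : P' ≤ A :=
    hge.trans (sup_le (inf_le_left.trans hPA) (hQA'.trans hA'A))
  have hTQ' : T ≤ P + Q - P' := by
    have hQ : Q ≤ P + Q - T := by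
      rw [add_sub_right_comm]
      exact le_add_of_nonneg_left (sub_nonneg.2 hTP)
    exact le_sub_comm.1 (hge.trans (sup_le inf_le_right hQ))
  have hQ'A' : P + Q - P' ≤ A' := by
    refine sub_le_comm.1 (le_trans (le_inf ?_ ?_) hle)
    · exact sub_le_iff_le_add.2 (add_le_add_right hQA' P)
    · exact sub_le_sub_left hTA' (P + Q)
  have hP' := hPmax P' hP'A hP'dom
  refine ⟨P + Q - P', hG.mem_argmaxOn_objective_iff.2 ⟨hQ'A', hQ'dom, fun ν hν hνdom =>
    (hQmax ν hν hνdom).trans ?_⟩, hTQ'⟩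
  rw [sub_dotProduct, add_dotProduct]
  linarith

end Disposals

section Duality

variable {ι : Type*} [Fintype ι] {G : (ι → ℝ) → EReal} {α A P : ι → ℝ} {τ : ι → EReal}

theorem le_of_forall_dotProduct_le {x y : ι → ℝ} {c : ℝ}
    (h : ∀ s, 0 ≤ s → x ⬝ᵥ s ≤ y ⬝ᵥ s + c) : x ≤ y := by
  classical
  intro i
  by_contra! hlt
  have hpos := sub_pos.2 hlt
  have hle := h (Pi.single i ((|c| + 1) / (x i - y i))) (Pi.single_nonneg.2 (by positivity))
  rw [dotProduct_single, dotProduct_single, ← sub_le_iff_le_add', ← sub_mul,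
    mul_div_cancel₀ _ hpos.ne'] at hle
  linarith [le_abs_self c]

/-- Strong duality, by minimax: `s` prices the constraint `μ ≤ A`. -/
theorem IsWelfare.exists_le_of_forall_le_ext (hG : IsWelfare G) {c : ℝ}
    (h : ∀ s, 0 ≤ s → (A ⬝ᵥ (α - s) : ℝ) ≤ c + ext G (fun i => ((α - s) i : EReal))) :
    ∃ μ ∈ dom (conj G), μ ≤ A ∧ A ⬝ᵥ α - c ≤ μ ⬝ᵥ α - (conj G μ).toReal := by
  let B : (ι → ℝ) →ₗ[ℝ] (ι → ℝ) →ₗ[ℝ] ℝ := dotProductBilin ℝ ℝ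
  have hB (μ s : ι → ℝ) : B μ s = μ ⬝ᵥ s := rfl
  have hcont (L : (ι → ℝ) →ₗ[ℝ] ℝ) (S : Set (ι → ℝ)) : LowerSemicontinuousOn L S :=
    L.continuous_of_finiteDimensional.lowerSemicontinuous.lowerSemicontinuousOn S
  have hconvex := hG.isProper_conj.convexOn_toReal hG.proper.isConvex_conj
  have hlsc := hG.isProper_conj.lowerSemicontinuousOn_toReal lowerSemicontinuous_conj
  obtain ⟨μ, hμ, hμle⟩ := exists_forall_add_bilin_le (B := B)
    (g := fun μ => (conj G μ).toReal + (-B.flip α) μ) (h := fun s => B A s + (c - A ⬝ᵥ α))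
    (fun μ => (B μ).continuous_of_finiteDimensional)
    (fun s => (B.flip s).continuous_of_finiteDimensional) hG.isProper_conj.2 hG.compact_dom
    (hconvex.add ((-B.flip α).convexOn hconvex.1)) (hlsc.add (hcont _ _))
    (((B A).convexOn (convex_Ici 0)).add_const _) ((hcont _ _).add lowerSemicontinuousOn_const)
    fun s hs => by
      obtain ⟨μ, hμ, heq⟩ := hG.exists_ext_coe_eq (α - s)
      have hle := h s hs
      rw [heq, hG.coe_objective hμ, ← EReal.coe_add, EReal.coe_le_coe_iff, dotProduct_sub,
        dotProduct_sub] at hle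
      refine ⟨μ, hμ, ?_⟩
      simp only [LinearMap.neg_apply, LinearMap.flip_apply, hB]
      linarith
  simp only [LinearMap.neg_apply, LinearMap.flip_apply, hB] at hμle
  refine ⟨μ, hμ, le_of_forall_dotProduct_le
    (c := c - A ⬝ᵥ α - ((conj G μ).toReal - μ ⬝ᵥ α)) fun s hs => ?_, ?_⟩
  · linarith [hμle s hs]
  · have hle := hμle 0 Set.self_mem_Ici
    rw [dotProduct_zero, dotProduct_zero] at hle
    linarith

theorem IsWelfare.dotProduct_add_conj_add_ext_le (hG : IsWelfare G) (hP : P ∈ disposals G α A)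
    (hτ : τ ∈ multipliers G α A) :
    (A ⬝ᵥ α : ℝ) + (conj G P + ext G (reduce α τ)) ≤
      pairing A (reduce α τ) + (P ⬝ᵥ α : ℝ) := by
  obtain ⟨hPA, hPdom, hPmax⟩ := hG.mem_argmaxOn_objective_iff.1 hP
  obtain ⟨hτ0, hτmax⟩ := hG.mem_multipliers_iff.1 hτ
  have hpairing := EReal.coe_toReal (pairing_ne_top ((hG.nonneg hPdom).trans hPA)
    (reduce_ne_top hτ0)) (hG.pairing_reduce_ne_bot hτ)
  have hext := hG.coe_toReal_ext_reduce (α := α) hτ0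
  obtain ⟨μ, hμ, hμA, hle⟩ := hG.exists_le_of_forall_le_ext (A := A) (α := α)
    (c := (pairing A (reduce α τ)).toReal - (ext G (reduce α τ)).toReal) fun s hs => by
      have h := hτmax (fun i => (s i : EReal)) fun i => EReal.coe_nonneg.2 (hs i)
      rw [reduce_coe, pairing_coe] at h
      rw [EReal.coe_sub, hpairing, sub_eq_add_neg (G := EReal), add_right_comm,
        ← sub_eq_add_neg (G := EReal), EReal.le_sub_iff_add_le (.inl (EReal.coe_ne_bot _))
        (.inl (EReal.coe_ne_top _)), hext]
      exact h
  have hval := hle.trans (hPmax μ hμA hμ)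
  rw [← hG.coe_toReal_conj hPdom, ← hext, ← hpairing]
  norm_cast
  linarith

theorem pairing_add_pairing_le_of_le {μ ν : ι → ℝ} {U V : ι → EReal} (hμ : 0 ≤ μ) (hμν : μ ≤ ν)
    (hUV : U ≤ V) : pairing μ V + pairing ν U ≤ pairing μ U + pairing ν V :=
  pairing_add_pairing_le fun i => mul_add_mul_le_of_rearrange (hμ i) (hμ i) rfl (hμν i) (hUV i)

theorem IsWelfare.mem_subdiff_of_mem_multipliers (hG : IsWelfare G) (hP : P ∈ disposals G α A)
    (hτ : τ ∈ multipliers G α A) : P ∈ subdiff G (reduce α τ) := by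
  obtain ⟨hPA, hPdom, -⟩ := hG.mem_argmaxOn_objective_iff.1 hP
  have hR : reduce α τ ≤ fun i => (α i : EReal) := by
    simpa only [reduce_zero] using reduce_antitone hτ.1
  have hrearrange := pairing_add_pairing_le_of_le (hG.nonneg hPdom) hPA hR
  rw [pairing_coe, pairing_coe] at hrearrange
  have hle := (hG.dotProduct_add_conj_add_ext_le hP hτ).trans
    ((add_comm _ _).trans_le (hrearrange.trans_eq (add_comm _ _)))
  exact hG.mem_subdiff_iff_conj_add_ext_le.2
    ⟨hPdom, (EReal.addLECancellable_coe _).add_le_add_iff_left.1 hle⟩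

theorem IsWelfare.eq_of_mem_multipliers_of_pos (hG : IsWelfare G) (hP : P ∈ disposals G α A)
    (hτ : τ ∈ multipliers G α A) {i : ι} (hi : 0 < τ i) : P i = A i := by
  classical
  obtain ⟨hPA, hPdom, -⟩ := hG.mem_argmaxOn_objective_iff.1 hP
  have hsubdiff := hG.mem_subdiff_of_mem_multipliers hP hτ
  obtain ⟨s, hs, hsτ⟩ := EReal.lt_iff_exists_real_btwn.1 hi
  have hsingle (j : ι) : ((Pi.single i s : ι → ℝ) j : EReal) ≤ τ j := by
    obtain rfl | hj := eq_or_ne j i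
    · simpa only [Pi.single_eq_same] using hsτ.le
    · rw [Pi.single_eq_of_ne hj, EReal.coe_zero]
      exact hτ.1 j
  have hR : reduce α τ ≤ fun j => (((α - Pi.single i s : ι → ℝ) j : ℝ) : EReal) :=
    reduce_antitone hsingle
  have hrearrange := pairing_add_pairing_le_of_le (hG.nonneg hPdom) hPA hR
  have hstrong := hG.dotProduct_add_conj_add_ext_le hP hτ
  rw [hsubdiff.2, add_comm] at hstrong
  have hle := add_le_add_of_add_le_add (hG.pairing_reduce_ne_bot hτ)
    (pairing_ne_top ((hG.nonneg hPdom).trans hPA) (reduce_ne_top hτ.1))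
    (hrearrange.trans_eq (add_comm _ _)) hstrong
  rw [pairing_coe, pairing_coe, ← EReal.coe_add, ← EReal.coe_add, EReal.coe_le_coe_iff] at hle
  simp only [dotProduct_sub, dotProduct_single] at hle
  exact (hPA i).antisymm (le_of_mul_le_mul_right (by linarith) (EReal.coe_pos.1 hs))

end Duality

section Runs

variable {ι : Type*} [Fintype ι] {G H : (ι → ℝ) → EReal} {α γ nG nH : ι → ℝ}

theorem IsWelfare.nonneg_of_mem_argmaxOn (hG : IsWelfare G) {S : Set (ι → ℝ)} {μ : ι → ℝ}
    (hμ : μ ∈ argmaxOn S (objective G α)) : 0 ≤ μ :=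
  hG.nonneg (hG.mem_argmaxOn_objective_iff.1 hμ).2.1

/-- The constraint that retained offers are not withdrawn never binds. -/
theorem Reachable.exists_mem_disposals_ge (hG : IsWelfare G) (hGs : IsSubmodular G)
    (hH : IsWelfare H) (hnG : nG ∈ upperBounds (dom (conj G)))
    (hnH : nH ∈ upperBounds (dom (conj H))) {A T : ι → ℝ} (h : Reachable G H α γ nG nH A T) :
    ∃ Q ∈ disposals G α A, T ≤ Q := by
  induction h with
  | init =>
    obtain ⟨Q, hQ⟩ :=
      hG.disposals_nonempty (le_inf (hnG hG.isLeast_zero.1) (hnH hH.isLeast_zero.1)) α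
    exact ⟨Q, hQ, hG.nonneg_of_mem_argmaxOn hQ⟩
  | @round A T P T' _ hP hT' ih =>
    obtain ⟨Q, hQ, hTQ⟩ := ih
    have hPA := mem_disposals_of_mem_proposals hQ hTQ hP
    have hT'A : T' ≤ A - (P - T') := le_sub_comm.1 (sub_le_sub_right hPA.1 T')
    exact hG.exists_mem_disposals_ge hGs hPA hT'.1 hT'A
      ((hH.nonneg_of_mem_argmaxOn hT').trans hT'A) (sub_le_self A (sub_nonneg.2 hT'.1))

theorem Reachable.nonneg_available (hG : IsWelfare G) (hGs : IsSubmodular G) (hH : IsWelfare H)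
    (hnG : nG ∈ upperBounds (dom (conj G))) (hnH : nH ∈ upperBounds (dom (conj H)))
    {A T : ι → ℝ} (h : Reachable G H α γ nG nH A T) : 0 ≤ A :=
  have ⟨_, hQ, _⟩ := h.exists_mem_disposals_ge hG hGs hH hnG hnH
  (hG.nonneg_of_mem_argmaxOn hQ).trans hQ.1

theorem Reachable.proposals_nonempty (hG : IsWelfare G) (hGs : IsSubmodular G) (hH : IsWelfare H)
    (hnG : nG ∈ upperBounds (dom (conj G))) (hnH : nH ∈ upperBounds (dom (conj H)))
    {A T : ι → ℝ} (h : Reachable G H α γ nG nH A T) : (proposals G α T A).Nonempty :=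
  have ⟨Q, hQ, hTQ⟩ := h.exists_mem_disposals_ge hG hGs hH hnG hnH
  ⟨Q, mem_proposals_of_mem_disposals hQ hTQ⟩

theorem exists_isRun (hG : IsWelfare G) (hGs : IsSubmodular G) (hH : IsWelfare H)
    (hnG : nG ∈ upperBounds (dom (conj G))) (hnH : nH ∈ upperBounds (dom (conj H)))
    (α γ : ι → ℝ) : ∃ μA μP μT : ℕ → ι → ℝ, IsRun G H α γ nG nH μA μP μT := by
  let State := {s : (ι → ℝ) × (ι → ℝ) // Reachable G H α γ nG nH s.1 s.2}
  have hround (s : State) : ∃ P T, P ∈ proposals G α s.1.2 s.1.1 ∧ T ∈ disposals H γ P := by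
    obtain ⟨P, hP⟩ := s.2.proposals_nonempty hG hGs hH hnG hnH
    obtain ⟨T, hT⟩ := hH.disposals_nonempty (hG.nonneg_of_mem_argmaxOn hP) γ
    exact ⟨P, T, hP, hT⟩
  choose P T hP hT using hround
  let next (s : State) : State := ⟨(s.1.1 - (P s - T s), T s), s.2.round (hP s) (hT s)⟩
  let state (k : ℕ) : State := Nat.rec ⟨(nG ⊓ nH, 0), .init⟩ (fun _ => next) k
  have hdelayed (k : ℕ) : delayed (fun k => T (state k)) k = (state k).1.2 := by
    cases k <;> rfl
  exact ⟨fun k => (state k).1.1, fun k => P (state k), fun k => T (state k), rfl,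
    fun k => (hdelayed k).symm ▸ hP (state k), fun k => hT (state k), fun k => rfl⟩

variable {μA μP μT : ℕ → ι → ℝ}

theorem IsRun.reachable (hr : IsRun G H α γ nG nH μA μP μT) (k : ℕ) :
    Reachable G H α γ nG nH (μA k) (delayed μT k) := by
  induction k with
  | zero => exact hr.init ▸ .init
  | succ k ih => exact hr.update k ▸ ih.round (hr.proposal k) (hr.disposal k)

theorem IsRun.exists_tendsto_subseq (hG : IsWelfare G) (hr : IsRun G H α γ nG nH μA μP μT) :
    ∃ φ : ℕ → ℕ, StrictMono φ ∧ ∃ (μ : ι → ℝ) (τP τT : ι → EReal),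
      Tendsto (fun j => μP (φ j)) atTop (𝓝 μ) ∧
      Tendsto (fun j => leastMultiplier G α (μA (φ j))) atTop (𝓝 τP) ∧
      Tendsto (fun j => leastMultiplier H γ (μP (φ j))) atTop (𝓝 τT) := by
  have hcompact : IsCompact (dom (conj G) ×ˢ (Set.univ : Set ((ι → EReal) × (ι → EReal)))) :=
    hG.compact_dom.prod isCompact_univ
  obtain ⟨⟨μ, τP, τT⟩, _, φ, hφ, hlim⟩ := hcompact.tendsto_subseq
    (x := fun k => (μP k, leastMultiplier G α (μA k), leastMultiplier H γ (μP k)))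
    fun k => ⟨(hG.mem_argmaxOn_objective_iff.1 (hr.proposal k)).2.1, trivial⟩
  rw [nhds_prod_eq, nhds_prod_eq] at hlim
  exact ⟨φ, hφ, μ, τP, τT, hlim.fst, hlim.snd.fst, hlim.snd.snd⟩

theorem IsRun.mem_disposals (hG : IsWelfare G) (hGs : IsSubmodular G) (hH : IsWelfare H)
    (hnG : nG ∈ upperBounds (dom (conj G))) (hnH : nH ∈ upperBounds (dom (conj H)))
    (hr : IsRun G H α γ nG nH μA μP μT) (k : ℕ) : μP k ∈ disposals G α (μA k) :=
  have ⟨_, hQ, hTQ⟩ := (hr.reachable k).exists_mem_disposals_ge hG hGs hH hnG hnH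
  mem_disposals_of_mem_proposals hQ hTQ (hr.proposal k)

theorem IsRun.antitone_available (hr : IsRun G H α γ nG nH μA μP μT) : Antitone μA :=
  antitone_nat_of_succ_le fun k =>
    (hr.update k).trans_le (sub_le_self _ (sub_nonneg.2 (hr.disposal k).1))

theorem IsRun.tendsto_rejected (hr : IsRun G H α γ nG nH μA μP μT) (hA : ∀ k, 0 ≤ μA k) :
    Tendsto (fun k => μP k - μT k) atTop (𝓝 0) := by
  have hlim : Tendsto μA atTop (𝓝 (⨅ k, μA k)) := tendsto_atTop_ciInf hr.antitone_available
    ⟨0, Set.forall_mem_range.2 hA⟩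
  have hdiff := hlim.sub (hlim.comp (tendsto_add_atTop_nat 1))
  rw [sub_self] at hdiff
  refine hdiff.congr fun k => ?_
  rw [Function.comp_apply, hr.update k, sub_sub_cancel]

theorem IsRun.antitone_leastMultiplier (hG : IsWelfare G) (hH : IsWelfare H)
    (hHs : IsSubmodular H) (hr : IsRun G H α γ nG nH μA μP μT) :
    Antitone fun k => leastMultiplier H γ (μP k) :=
  antitone_nat_of_succ_le fun k => by
    have hT := hH.nonneg_of_mem_argmaxOn (hr.disposal k)
    have hleast := hH.isLeast_leastMultiplier (α := γ) hHs
      (hG.nonneg_of_mem_argmaxOn (hr.proposal k))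
    calc leastMultiplier H γ (μP (k + 1))
      _ ≤ leastMultiplier H γ (μT k) :=
        hH.leastMultiplier_le_of_le hHs hT (hr.proposal (k + 1)).1.1
      _ ≤ leastMultiplier H γ (μP k) :=
        (hH.isLeast_leastMultiplier hHs hT).2 (hH.mem_multipliers_of_mem_subdiff hleast.1.1
          (hH.mem_subdiff_of_mem_multipliers (hr.disposal k) hleast.1))

/-- An offer with positive disposal price is never rejected. -/
theorem IsRun.available_eq_of_forall_pos (hG : IsWelfare G) (hH : IsWelfare H)
    (hHs : IsSubmodular H) (hr : IsRun G H α γ nG nH μA μP μT) {i : ι}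
    (hi : ∀ k, 0 < leastMultiplier H γ (μP k) i) (k : ℕ) : μA k i = (nG ⊓ nH) i := by
  induction k with
  | zero => rw [hr.init]
  | succ k ih =>
    have hT := hH.eq_of_mem_multipliers_of_pos (hr.disposal k) (hH.isLeast_leastMultiplier hHs
      (hG.nonneg_of_mem_argmaxOn (hr.proposal k))).1 (hi k)
    rw [hr.update k, Pi.sub_apply, Pi.sub_apply, hT, sub_self, sub_zero, ih]

theorem IsRun.eq_of_tendsto_of_pos (hG : IsWelfare G) (hGs : IsSubmodular G) (hH : IsWelfare H)
    (hHs : IsSubmodular H) (hnG : nG ∈ upperBounds (dom (conj G)))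
    (hnH : nH ∈ upperBounds (dom (conj H))) (hr : IsRun G H α γ nG nH μA μP μT)
    {φ : ℕ → ℕ} (hφ : StrictMono φ) {μ : ι → ℝ} {τP τT : ι → EReal}
    (hμ : Tendsto (fun j => μP (φ j)) atTop (𝓝 μ))
    (hτP : Tendsto (fun j => leastMultiplier G α (μA (φ j))) atTop (𝓝 τP))
    (hτT : Tendsto (fun j => leastMultiplier H γ (μP (φ j))) atTop (𝓝 τT))
    {i : ι} (hP : 0 < τP i) (hT : 0 < τT i) : μ i = (nG ⊓ nH) i := by
  have hanti := hr.antitone_leastMultiplier hG hH hHs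
  have hpos (k : ℕ) : 0 < leastMultiplier H γ (μP k) i := hT.trans_le <|
    ((hanti.comp_monotone hφ.monotone).le_of_tendsto hτT k i).trans (hanti (hφ.le_apply) i)
  refine tendsto_nhds_unique (tendsto_pi_nhds.1 hμ i) (tendsto_const_nhds.congr' ?_)
  filter_upwards [(tendsto_pi_nhds.1 hτP i).eventually (lt_mem_nhds hP)] with j hj
  have hA := (hr.reachable (φ j)).nonneg_available hG hGs hH hnG hnH
  rw [hG.eq_of_mem_multipliers_of_pos (hr.mem_disposals hG hGs hH hnG hnH (φ j))
    (hG.isLeast_leastMultiplier hGs hA).1 hj,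
    hr.available_eq_of_forall_pos hG hH hHs hpos]

end Runs

section Equilibrium

variable {ι : Type*} [Fintype ι] {G H : (ι → ℝ) → EReal} {α γ nG nH : ι → ℝ}

theorem coe_sub_sub_self (a : ℝ) (t : EReal) : (a : EReal) - t - a = -t := by
  induction t with
  | bot => simp
  | top => simp
  | coe t =>
    norm_cast
    ring

theorem IsWelfare.mem_subdiff_reduce_indicator (hG : IsWelfare G) {μ n : ι → ℝ} {τ : ι → EReal}
    (hn : n ∈ upperBounds (dom (conj G))) (hτ : 0 ≤ τ) (hμ : μ ∈ subdiff G (reduce α τ)) :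
    μ ∈ subdiff G (reduce α ({i | μ i < n i}.indicator τ)) := by
  refine hG.mem_subdiff_of_le hμ (reduce_ne_top hτ)
    (reduce_antitone (Set.indicator_le_self' fun i _ => hτ i)) fun i hi ν hν => ?_
  have hmem : i ∉ {i | μ i < n i} := fun h => hi (by rw [reduce, reduce, Set.indicator_of_mem h])
  exact (hn hν i).trans (not_lt.1 hmem)

theorem IsGenEquilibrium.of_mem_subdiff {μ : ι → ℝ} {σ τ : ι → EReal} (hσ : 0 ≤ σ) (hτ : 0 ≤ τ)
    (hslack : ∀ i, σ i = 0 ∨ τ i = 0) (hG : μ ∈ subdiff G (reduce α σ))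
    (hH : μ ∈ subdiff H (reduce γ τ)) :
    IsGenEquilibrium G H α γ μ (reduce α σ) (reduce γ τ) := by
  refine ⟨reduce_ne_top hσ, reduce_ne_top hτ, fun i => ?_, hG, hH⟩
  rw [reduce, reduce, coe_sub_sub_self, coe_sub_sub_self]
  obtain h | h := hslack i
  · rw [h, neg_zero]
    exact max_eq_left (EReal.neg_le_zero.2 (hτ i))
  · rw [h, neg_zero]
    exact max_eq_right (EReal.neg_le_zero.2 (hσ i))

theorem IsRun.isGenEquilibrium (hG : IsWelfare G) (hGs : IsSubmodular G) (hH : IsWelfare H)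
    (hHs : IsSubmodular H) (hnG : nG ∈ upperBounds (dom (conj G)))
    (hnH : nH ∈ upperBounds (dom (conj H))) {μA μP μT : ℕ → ι → ℝ}
    (hr : IsRun G H α γ nG nH μA μP μT)
    {φ : ℕ → ℕ} (hφ : StrictMono φ) {μ : ι → ℝ} {τP τT : ι → EReal}
    (hμ : Tendsto (fun j => μP (φ j)) atTop (𝓝 μ))
    (hτP : Tendsto (fun j => leastMultiplier G α (μA (φ j))) atTop (𝓝 τP))
    (hτT : Tendsto (fun j => leastMultiplier H γ (μP (φ j))) atTop (𝓝 τT)) :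
    IsGenEquilibrium G H α γ μ (reduce α ({i | μ i < nG i}.indicator τP))
      (reduce γ ({i | μ i < nH i}.indicator τT)) := by
  have hA (k : ℕ) := (hr.reachable k).nonneg_available hG hGs hH hnG hnH
  have hleastP (j : ℕ) := (hG.isLeast_leastMultiplier (α := α) hGs (hA (φ j))).1
  have hleastT (j : ℕ) := (hH.isLeast_leastMultiplier (α := γ) hHs
    (hG.nonneg_of_mem_argmaxOn (hr.proposal (φ j)))).1
  have hτP0 : 0 ≤ τP := ge_of_tendsto' hτP fun j => (hleastP j).1
  have hτT0 : 0 ≤ τT := ge_of_tendsto' hτT fun j => (hleastT j).1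
  have hμT : Tendsto (fun j => μT (φ j)) atTop (𝓝 μ) := by
    simpa only [Function.comp_apply, sub_zero, sub_sub_cancel] using
      hμ.sub ((hr.tendsto_rejected hA).comp hφ.tendsto_atTop)
  have hμG : μ ∈ subdiff G (reduce α τP) := hG.mem_subdiff_of_tendsto hμ
    ((continuous_reduce.tendsto _).comp hτP) (reduce_ne_top hτP0)
    (fun j => reduce_ne_top (hleastP j).1) fun j =>
      hG.mem_subdiff_of_mem_multipliers (hr.mem_disposals hG hGs hH hnG hnH (φ j)) (hleastP j)
  have hμH : μ ∈ subdiff H (reduce γ τT) := hH.mem_subdiff_of_tendsto hμT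
    ((continuous_reduce.tendsto _).comp hτT) (reduce_ne_top hτT0)
    (fun j => reduce_ne_top (hleastT j).1) fun j =>
      hH.mem_subdiff_of_mem_multipliers (hr.disposal (φ j)) (hleastT j)
  refine .of_mem_subdiff (fun i => Set.indicator_apply_nonneg fun _ => hτP0 i)
    (fun i => Set.indicator_apply_nonneg fun _ => hτT0 i) (fun i => ?_)
    (hG.mem_subdiff_reduce_indicator hnG hτP0 hμG) (hH.mem_subdiff_reduce_indicator hnH hτT0 hμH)
  by_contra! hne
  rw [Set.indicator_apply_ne_zero, Set.indicator_apply_ne_zero] at hne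
  obtain ⟨⟨hiG, hP⟩, hiH, hT⟩ := hne
  have heq := hr.eq_of_tendsto_of_pos hG hGs hH hHs hnG hnH hφ hμ hτP hτT
    ((hτP0 i).lt_of_ne' hP) ((hτT0 i).lt_of_ne' hT)
  exact heq.not_lt (lt_inf_iff.2 ⟨hiG, hiH⟩)

end Equilibrium

end AggDA

theorem mainTheorem2_general {ι : Type*} [Fintype ι]
    (G H : (ι → ℝ) → EReal)
    (hG : AggDA.IsWelfare G) (hGsub : AggDA.IsSubmodular G)
    (hH : AggDA.IsWelfare H) (hHsub : AggDA.IsSubmodular H)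
    (α γ : ι → ℝ) :
    (∀ nG ∈ upperBounds (AggDA.dom (AggDA.conj G)),
      ∀ nH ∈ upperBounds (AggDA.dom (AggDA.conj H)),
      (∀ A T : ι → ℝ, AggDA.Reachable G H α γ nG nH A T →
        (AggDA.proposals G α T A).Nonempty ∧
        IsLeast (AggDA.multipliers G α A) (AggDA.leastMultiplier G α A) ∧
        ∀ P ∈ AggDA.proposals G α T A,
          (AggDA.disposals H γ P).Nonempty ∧
          IsLeast (AggDA.multipliers H γ P) (AggDA.leastMultiplier H γ P)) ∧
      (∃ μA μP μT : ℕ → ι → ℝ, AggDA.IsRun G H α γ nG nH μA μP μT) ∧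
      (∀ μA μP μT : ℕ → ι → ℝ, AggDA.IsRun G H α γ nG nH μA μP μT →
        (∃ φ : ℕ → ℕ, StrictMono φ ∧
          ∃ (μ : ι → ℝ) (τP τT : ι → EReal),
            Tendsto (fun j => μP (φ j)) atTop (𝓝 μ) ∧
            Tendsto (fun j => AggDA.leastMultiplier G α (μA (φ j))) atTop (𝓝 τP) ∧
            Tendsto (fun j => AggDA.leastMultiplier H γ (μP (φ j))) atTop (𝓝 τT)) ∧
        (∀ φ : ℕ → ℕ, StrictMono φ →
          ∀ (μ : ι → ℝ) (τP τT : ι → EReal),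
            Tendsto (fun j => μP (φ j)) atTop (𝓝 μ) →
            Tendsto (fun j => AggDA.leastMultiplier G α (μA (φ j))) atTop (𝓝 τP) →
            Tendsto (fun j => AggDA.leastMultiplier H γ (μP (φ j))) atTop (𝓝 τT) →
            AggDA.IsGenEquilibrium G H α γ μ
              (AggDA.reduce α ({i | μ i < nG i}.indicator τP))
              (AggDA.reduce γ ({i | μ i < nH i}.indicator τT))))) ∧
    (∃ (μ : ι → ℝ) (U V : ι → EReal), AggDA.IsGenEquilibrium G H α γ μ U V) := by
  refine ⟨fun nG hnG nH hnH => ⟨fun A T hAT => ?_,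
    AggDA.exists_isRun hG hGsub hH hnG hnH α γ, fun μA μP μT hr =>
      ⟨hr.exists_tendsto_subseq hG, fun φ hφ μ τP τT hμ hτP hτT =>
        hr.isGenEquilibrium hG hGsub hH hHsub hnG hnH hφ hμ hτP hτT⟩⟩, ?_⟩
  · refine ⟨hAT.proposals_nonempty hG hGsub hH hnG hnH, hG.isLeast_leastMultiplier hGsub
      (hAT.nonneg_available hG hGsub hH hnG hnH), fun P hP => ?_⟩
    have hP0 : 0 ≤ P := hG.nonneg_of_mem_argmaxOn hP
    exact ⟨hH.disposals_nonempty hP0 γ, hH.isLeast_leastMultiplier hHsub hP0⟩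
  · obtain ⟨nG, hnG⟩ := hG.compact_dom.isBounded.bddAbove
    obtain ⟨nH, hnH⟩ := hH.compact_dom.isBounded.bddAbove
    obtain ⟨μA, μP, μT, hr⟩ := AggDA.exists_isRun hG hGsub hH hnG hnH α γ
    obtain ⟨φ, hφ, μ, τP, τT, hμ, hτP, hτT⟩ := hr.exists_tendsto_subseq hG
    exact ⟨μ, _, _, hr.isGenEquilibrium hG hGsub hH hHsub hnG hnH hφ hμ hτP hτT⟩

theorem mainTheorem2 {X Y : Type*} [Fintype X] [Fintype Y]
    (G H : (X × Y → ℝ) → EReal)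
    (hG : AggDA.IsWelfare G) (hGsub : AggDA.IsSubmodular G)
    (hH : AggDA.IsWelfare H) (hHsub : AggDA.IsSubmodular H)
    (α γ : X × Y → ℝ) :
    (∀ nG ∈ upperBounds (AggDA.dom (AggDA.conj G)),
      ∀ nH ∈ upperBounds (AggDA.dom (AggDA.conj H)),
      -- whatever maximizers were chosen before, every phase of the algorithm can be carried out,
      -- and the multipliers have least elements
      (∀ A T : X × Y → ℝ, AggDA.Reachable G H α γ nG nH A T →
        (AggDA.proposals G α T A).Nonempty ∧
        IsLeast (AggDA.multipliers G α A) (AggDA.leastMultiplier G α A) ∧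
        ∀ P ∈ AggDA.proposals G α T A,
          (AggDA.disposals H γ P).Nonempty ∧
          IsLeast (AggDA.multipliers H γ P) (AggDA.leastMultiplier H γ P)) ∧
      (∃ μA μP μT : ℕ → X × Y → ℝ, AggDA.IsRun G H α γ nG nH μA μP μT) ∧
      -- convergence, for every run of the algorithm
      (∀ μA μP μT : ℕ → X × Y → ℝ, AggDA.IsRun G H α γ nG nH μA μP μT →
        (∃ φ : ℕ → ℕ, StrictMono φ ∧
          ∃ (μ : X × Y → ℝ) (τP τT : X × Y → EReal),
            Tendsto (fun j => μP (φ j)) atTop (𝓝 μ) ∧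
            Tendsto (fun j => AggDA.leastMultiplier G α (μA (φ j))) atTop (𝓝 τP) ∧
            Tendsto (fun j => AggDA.leastMultiplier H γ (μP (φ j))) atTop (𝓝 τT)) ∧
        (∀ φ : ℕ → ℕ, StrictMono φ →
          ∀ (μ : X × Y → ℝ) (τP τT : X × Y → EReal),
            Tendsto (fun j => μP (φ j)) atTop (𝓝 μ) →
            Tendsto (fun j => AggDA.leastMultiplier G α (μA (φ j))) atTop (𝓝 τP) →
            Tendsto (fun j => AggDA.leastMultiplier H γ (μP (φ j))) atTop (𝓝 τT) →
            AggDA.IsGenEquilibrium G H α γ μ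
              (AggDA.reduce α ({i | μ i < nG i}.indicator τP))
              (AggDA.reduce γ ({i | μ i < nH i}.indicator τT))))) ∧
    -- existence of generalized equilibrium matchings
    (∃ (μ : X × Y → ℝ) (U V : X × Y → EReal), AggDA.IsGenEquilibrium G H α γ μ U V) :=
  mainTheorem2_general G H hG hGsub hH hHsub α γ
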